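/- Let $\mathbb{F}$ be a field and let $\Gamma=(V,E,s,t)$ be a row-finite directed graph (each vertex is the source of only finitely many arrows; $V$ and $E$ may be infinite, loops and multiple arrows are allowed). Let $L=L_{\mathbb{F}}(\Gamma)$ be its Leavitt path algebra, i.e. the (not necessarily unital) $\mathbb{F}$-algebra generated by $V\sqcup E\sqcup E^*$, $E^*=\{e^*: e\in E\}$, subject to $vw=\delta_{v,w}v$ for $v,w\in V$; $s(e)e=e=e\,t(e)$ and $t(e)e^*=e^*=e^*s(e)$ for $e\in E$; $e^*f=\delta_{e,f}\,t(e)$ for $e,f\in E$; and $v=\sum_{s(e)=v}ee^*$ for every $v\in V$ with $0<|s^{-1}(v)|<\infty$. Then there is an equivalence of categories $$\mathfrak{M}_L^{fd}\;\simeq\;\Big(\bigoplus_{\mathcal{S}}\mathfrak{M}_{\mathbb{F}}^{fd}\Big)\oplus\Big(\bigoplus_{\mathcal{T}}\mathfrak{M}_{\mathbb{F}[x,x^{-1}]}^{fd}\Big).$$ Here $\mathfrak{M}_A^{fd}$ is the category of unital right $A$-modules ($MA=M$) that are finite dimensional over $\mathbb{F}$. The direct sum of a family of categories has as objects the families of objects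 of which all but finitely many are zero, and as morphisms the families of morphisms. A cycle is a closed path $e_1\cdots e_n$ ($n>0$) with $s(e_i)\ne s(e_j)$ for $i\neq j$, considered up to cyclic permutation. $\mathcal{S}$ is the set of sinks $w$ such that there is no path from any cycle to $w$ and only finitely many vertices have a path to $w$. $\mathcal{T}$ is the set of cycles $C$ such that there is no path from any other cycle to $C$ and only finitely many vertices have a path to $C$. -/

import Mathlib

open CategoryTheory

universe u v k w

/-- A directed graph `(V, E, s, t)`: multiple arrows and loops are allowed. -/
structure DiGraph (V : Type u) (E : Type v) where
  /-- the source function -/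
  s : E → V
  /-- the target function -/
  t : E → V

namespace DiGraph

variable {V : Type u} {E : Type v}

/-- Every vertex emits only finitely many arrows. -/
def RowFinite (Γ : DiGraph V E) : Prop :=
  ∀ x : V, (Γ.s ⁻¹' {x}).Finite

/-- A vertex that emits no arrow. -/
def IsSink (Γ : DiGraph V E) (x : V) : Prop :=
  Γ.s ⁻¹' {x} = ∅

/-- There is a (possibly trivial) directed path from `x` to `y`. -/
def Leads (Γ : DiGraph V E) (x y : V) : Prop :=
  Relation.ReflTransGen (fun a b => ∃ e : E, Γ.s e = a ∧ Γ.t e = b) x y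

/-- A cycle of the graph: a closed path `e₁ ⋯ eₙ` with `n > 0` whose arrows have pairwise different
sources, where closed paths that are rotations of each other are identified
(Mathlib's `Cycle E` is the type of lists of arrows up to rotation). -/
def IsCycle (Γ : DiGraph V E) (C : Cycle E) : Prop :=
  C ≠ Cycle.nil ∧ C.Chain (fun e f => Γ.t e = Γ.s f) ∧ (C.map Γ.s).Nodup

/-- The sink `x` is not reachable from any cycle. -/
def IsMaximalSink (Γ : DiGraph V E) (x : V) : Prop :=
  Γ.IsSink x ∧ ∀ C : Cycle E, Γ.IsCycle C → ∀ e ∈ C, ¬ Γ.Leads (Γ.s e) x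

/-- `C` is a cycle and no other cycle connects to it. -/
def IsMaximalCycle (Γ : DiGraph V E) (C : Cycle E) : Prop :=
  Γ.IsCycle C ∧ ∀ D : Cycle E, Γ.IsCycle D →
    (∃ e ∈ D, ∃ f ∈ C, Γ.Leads (Γ.s e) (Γ.s f)) → D = C

/-- The predecessors of a vertex: all vertices from which there is a path to it. -/
def predecessors (Γ : DiGraph V E) (x : V) : Set V :=
  {y | Γ.Leads y x}

/-- The predecessors of a cycle: all vertices from which there is a path to a vertex on it. -/
def cyclePredecessors (Γ : DiGraph V E) (C : Cycle E) : Set V :=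
  {y | ∃ e ∈ C, Γ.Leads y (Γ.s e)}

/-- The set of maximal sinks with finitely many predecessors. -/
def finMaximalSinks (Γ : DiGraph V E) : Set V :=
  {x | Γ.IsMaximalSink x ∧ (Γ.predecessors x).Finite}

/-- The set of maximal cycles with finitely many predecessors. -/
def finMaximalCycles (Γ : DiGraph V E) : Set (Cycle E) :=
  {C | Γ.IsMaximalCycle C ∧ (Γ.cyclePredecessors C).Finite}

/-- The generators `V ⊔ E ⊔ E*` of the Leavitt path algebra. -/
inductive Gen (V : Type u) (E : Type v) : Type (max u v)
  | vertex : V → Gen V E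
  | arrow : E → Gen V E
  | ghost : E → Gen V E

/-- A family of elements of a (not necessarily unital) ring, indexed by `V ⊔ E ⊔ E*`, satisfies the
defining relations of the Leavitt path algebra. -/
structure IsLeavittFamily (Γ : DiGraph V E) {B : Type*} [NonUnitalRing B] (g : Gen V E → B) :
    Prop where
  vertex_mul_self : ∀ x, g (.vertex x) * g (.vertex x) = g (.vertex x)
  vertex_mul_of_ne : ∀ x y, x ≠ y → g (.vertex x) * g (.vertex y) = 0
  source_mul_arrow : ∀ e, g (.vertex (Γ.s e)) * g (.arrow e) = g (.arrow e)
  arrow_mul_target : ∀ e, g (.arrow e) * g (.vertex (Γ.t e)) = g (.arrow e)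
  target_mul_ghost : ∀ e, g (.vertex (Γ.t e)) * g (.ghost e) = g (.ghost e)
  ghost_mul_source : ∀ e, g (.ghost e) * g (.vertex (Γ.s e)) = g (.ghost e)
  ck1_self : ∀ e, g (.ghost e) * g (.arrow e) = g (.vertex (Γ.t e))
  ck1_of_ne : ∀ e f, e ≠ f → g (.ghost e) * g (.arrow f) = 0
  ck2 : ∀ (x : V) (h : (Γ.s ⁻¹' {x}).Finite), (Γ.s ⁻¹' {x}).Nonempty →
    g (.vertex x) = ∑ e ∈ h.toFinset, g (.arrow e) * g (.ghost e)

section Algebra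

variable (F : Type k) [Field F] (Γ : DiGraph V E)

/-- The same relations, in the free unital algebra on `V ⊔ E ⊔ E*`. -/
inductive LeavittRel : FreeAlgebra F (Gen V E) → FreeAlgebra F (Gen V E) → Prop
  | vertex_mul_self (x : V) :
      LeavittRel (FreeAlgebra.ι F (.vertex x) * FreeAlgebra.ι F (.vertex x))
        (FreeAlgebra.ι F (.vertex x))
  | vertex_mul_of_ne (x y : V) (h : x ≠ y) :
      LeavittRel (FreeAlgebra.ι F (.vertex x) * FreeAlgebra.ι F (.vertex y)) 0
  | source_mul_arrow (e : E) :
      LeavittRel (FreeAlgebra.ι F (.vertex (Γ.s e)) * FreeAlgebra.ι F (.arrow e))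
        (FreeAlgebra.ι F (.arrow e))
  | arrow_mul_target (e : E) :
      LeavittRel (FreeAlgebra.ι F (.arrow e) * FreeAlgebra.ι F (.vertex (Γ.t e)))
        (FreeAlgebra.ι F (.arrow e))
  | target_mul_ghost (e : E) :
      LeavittRel (FreeAlgebra.ι F (.vertex (Γ.t e)) * FreeAlgebra.ι F (.ghost e))
        (FreeAlgebra.ι F (.ghost e))
  | ghost_mul_source (e : E) :
      LeavittRel (FreeAlgebra.ι F (.ghost e) * FreeAlgebra.ι F (.vertex (Γ.s e)))
        (FreeAlgebra.ι F (.ghost e))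
  | ck1_self (e : E) :
      LeavittRel (FreeAlgebra.ι F (.ghost e) * FreeAlgebra.ι F (.arrow e))
        (FreeAlgebra.ι F (.vertex (Γ.t e)))
  | ck1_of_ne (e f : E) (h : e ≠ f) :
      LeavittRel (FreeAlgebra.ι F (.ghost e) * FreeAlgebra.ι F (.arrow f)) 0
  | ck2 (x : V) (h : (Γ.s ⁻¹' {x}).Finite) (hne : (Γ.s ⁻¹' {x}).Nonempty) :
      LeavittRel (FreeAlgebra.ι F (.vertex x))
        (∑ e ∈ h.toFinset, FreeAlgebra.ι F (.arrow e) * FreeAlgebra.ι F (.ghost e))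

/-- The image of a generator in the unital algebra presented by the relations. -/
def unitalGen (x : Gen V E) : RingQuot (LeavittRel F Γ) :=
  RingQuot.mkAlgHom F (LeavittRel F Γ) (FreeAlgebra.ι F x)

/-- The Leavitt path algebra `L_F(Γ)`: the (not necessarily unital) `F`-algebra presented by the
generators `V ⊔ E ⊔ E*` and the relations of `IsLeavittFamily`.  The unital algebra with this
presentation is its unitization, so it is realised there as the non-unital subalgebra generated
by the generators; `LeavittPathAlgebra.existsUnique_lift` is its universal property. -/
abbrev LeavittPathAlgebra : Type (max u v k) :=
  NonUnitalAlgebra.adjoin F (Set.range (unitalGen F Γ))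

/-- The generators as elements of the Leavitt path algebra. -/
def LeavittPathAlgebra.gen (x : Gen V E) : LeavittPathAlgebra F Γ :=
  ⟨unitalGen F Γ x, NonUnitalAlgebra.subset_adjoin F ⟨x, rfl⟩⟩

theorem isLeavittFamily_unitalGen : Γ.IsLeavittFamily (unitalGen F Γ) where
  vertex_mul_self x := by
    simpa [unitalGen] using RingQuot.mkAlgHom_rel F (LeavittRel.vertex_mul_self (F := F) (Γ := Γ) x)
  vertex_mul_of_ne x y h := by
    simpa [unitalGen] using
      RingQuot.mkAlgHom_rel F (LeavittRel.vertex_mul_of_ne (F := F) (Γ := Γ) x y h)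
  source_mul_arrow e := by
    simpa [unitalGen] using
      RingQuot.mkAlgHom_rel F (LeavittRel.source_mul_arrow (F := F) (Γ := Γ) e)
  arrow_mul_target e := by
    simpa [unitalGen] using
      RingQuot.mkAlgHom_rel F (LeavittRel.arrow_mul_target (F := F) (Γ := Γ) e)
  target_mul_ghost e := by
    simpa [unitalGen] using
      RingQuot.mkAlgHom_rel F (LeavittRel.target_mul_ghost (F := F) (Γ := Γ) e)
  ghost_mul_source e := by
    simpa [unitalGen] using
      RingQuot.mkAlgHom_rel F (LeavittRel.ghost_mul_source (F := F) (Γ := Γ) e)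
  ck1_self e := by
    simpa [unitalGen] using RingQuot.mkAlgHom_rel F (LeavittRel.ck1_self (F := F) (Γ := Γ) e)
  ck1_of_ne e f h := by
    simpa [unitalGen] using RingQuot.mkAlgHom_rel F (LeavittRel.ck1_of_ne (F := F) (Γ := Γ) e f h)
  ck2 x h hne := by
    simpa [unitalGen] using RingQuot.mkAlgHom_rel F (LeavittRel.ck2 (F := F) (Γ := Γ) x h hne)

theorem isLeavittFamily_gen : Γ.IsLeavittFamily (LeavittPathAlgebra.gen F Γ) := by
  have H := isLeavittFamily_unitalGen F Γ
  refine ⟨fun x => Subtype.ext (H.1 x), fun x y h => Subtype.ext (H.2 x y h),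
    fun e => Subtype.ext (H.3 e), fun e => Subtype.ext (H.4 e), fun e => Subtype.ext (H.5 e),
    fun e => Subtype.ext (H.6 e), fun e => Subtype.ext (H.7 e),
    fun e f h => Subtype.ext (H.8 e f h), fun x h hne => Subtype.ext ?_⟩
  rw [AddSubmonoidClass.coe_finsetSum]
  exact H.9 x h hne

/-- Every Leavitt family in a non-unital `F`-algebra extends uniquely to a homomorphism. -/
theorem LeavittPathAlgebra.existsUnique_lift {B : Type*} [NonUnitalRing B] [Module F B]
    [IsScalarTower F B B] [SMulCommClass F B B] (g : Gen V E → B) (hg : Γ.IsLeavittFamily g) :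
    ∃! φ : LeavittPathAlgebra F Γ →ₙₐ[F] B, ∀ x, φ (LeavittPathAlgebra.gen F Γ x) = g x := by
  classical
  let Φ₀ : FreeAlgebra F (Gen V E) →ₐ[F] Unitization F B :=
    FreeAlgebra.lift F (fun x => (g x : Unitization F B))
  have hΦ₀ : ∀ ⦃a b⦄, LeavittRel F Γ a b → Φ₀ a = Φ₀ b := by
    intro a b hab
    induction hab with
    | vertex_mul_self x => simp [Φ₀, ← Unitization.inr_mul, hg.vertex_mul_self]
    | vertex_mul_of_ne x y h => simp [Φ₀, ← Unitization.inr_mul, hg.vertex_mul_of_ne x y h]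
    | source_mul_arrow e => simp [Φ₀, ← Unitization.inr_mul, hg.source_mul_arrow]
    | arrow_mul_target e => simp [Φ₀, ← Unitization.inr_mul, hg.arrow_mul_target]
    | target_mul_ghost e => simp [Φ₀, ← Unitization.inr_mul, hg.target_mul_ghost]
    | ghost_mul_source e => simp [Φ₀, ← Unitization.inr_mul, hg.ghost_mul_source]
    | ck1_self e => simp [Φ₀, ← Unitization.inr_mul, hg.ck1_self]
    | ck1_of_ne e f h => simp [Φ₀, ← Unitization.inr_mul, hg.ck1_of_ne e f h]
    | ck2 x h hne =>
      simp only [Φ₀, map_sum, map_mul, FreeAlgebra.lift_ι_apply, ← Unitization.inr_mul,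
        hg.ck2 x h hne]
      exact map_sum (Unitization.inrNonUnitalAlgHom F B) _ _
  let Φ : RingQuot (LeavittRel F Γ) →ₐ[F] Unitization F B :=
    RingQuot.liftAlgHom F ⟨Φ₀, hΦ₀⟩
  have hΦ : ∀ x, Φ (unitalGen F Γ x) = (g x : Unitization F B) := by
    intro x
    simp [Φ, unitalGen, Φ₀]
  have hfst : ∀ a : LeavittPathAlgebra F Γ, (Φ a).fst = 0 := by
    rintro ⟨a, ha⟩
    induction ha using NonUnitalAlgebra.adjoin_induction with
    | mem x hx => obtain ⟨y, rfl⟩ := hx; simp [hΦ]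
    | add x y hx hy h1 h2 => simp_all
    | zero => simp
    | mul x y hx hy h1 h2 => simp_all
    | smul r x hx h => simp_all
  refine ⟨{ toFun := fun a => (Φ a).snd, map_smul' := ?_, map_zero' := ?_, map_add' := ?_,
            map_mul' := ?_ }, ?_, ?_⟩
  · intro r a; simp
  · simp
  · intro a b; simp
  · intro a b; simp [hfst]
  · intro x
    change (Φ (unitalGen F Γ x)).snd = g x
    simp [hΦ]
  · intro ψ hψ
    ext ⟨a, ha⟩
    change ψ ⟨a, ha⟩ = (Φ a).snd
    induction ha using NonUnitalAlgebra.adjoin_induction with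
    | mem x hx => 
      obtain ⟨y, rfl⟩ := hx
      rw [hΦ, Unitization.snd_inr]
      exact hψ y
    | add x y hx hy h1 h2 =>
      rw [map_add, Unitization.snd_add, ← h1, ← h2, ← map_add]; rfl
    | zero => rw [map_zero]; exact map_zero ψ
    | mul x y hx hy h1 h2 =>
      have e : (Φ (x * y)).snd = (Φ x).snd * (Φ y).snd := by
        have a1 : (Φ x).fst = 0 := hfst ⟨x, hx⟩
        have a2 : (Φ y).fst = 0 := hfst ⟨y, hy⟩
        simp [a1, a2]
      rw [e, ← h1, ← h2, ← map_mul]; rfl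
    | smul r x hx h => rw [map_smul, Unitization.snd_smul, ← h, ← map_smul]; rfl

end Algebra

end DiGraph

/-- A unital right module over a (not necessarily unital) `F`-algebra `A`: an `F`-vector space `M`
with a right action of `A` such that `M A = M`. -/
structure RightModCat (F : Type k) [Field F] (A : Type v) [NonUnitalRing A] [Module F A] where
  /-- the underlying vector space -/
  carrier : Type w
  [addCommGroup : AddCommGroup carrier]
  [module : Module F carrier]
  /-- `m · a` is `(act a).unop m`; the opposite algebra makes this a right action -/
  act : A →ₙₐ[F] (Module.End F carrier)ᵐᵒᵖ
  unital : Submodule.span F {x : carrier | ∃ (m : carrier) (a : A), x = (act a).unop m} = ⊤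

namespace RightModCat

variable {F : Type k} [Field F] {A : Type v} [NonUnitalRing A] [Module F A]

instance : CoeSort (RightModCat.{v, k, w} F A) (Type w) := ⟨carrier⟩

attribute [instance] addCommGroup module

/-- Homomorphisms of right `A`-modules. -/
@[ext]
structure Hom (M N : RightModCat.{v, k, w} F A) where
  /-- the underlying linear map -/
  toLin : M →ₗ[F] N
  map_act : ∀ (a : A) (m : M), toLin ((M.act a).unop m) = (N.act a).unop (toLin m)

instance : Category (RightModCat.{v, k, w} F A) where
  Hom M N := Hom M N
  id M := ⟨LinearMap.id, fun _ _ => rfl⟩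
  comp f g := ⟨g.toLin ∘ₗ f.toLin, fun a m => by simp [f.map_act, g.map_act]⟩

/-- The modules whose underlying vector space is finite dimensional. -/
def isFinDim (F : Type k) [Field F] (A : Type v) [NonUnitalRing A] [Module F A] :
    ObjectProperty (RightModCat.{v, k, w} F A) :=
  fun M => Module.Finite F M

end RightModCat

/-- The category of finite dimensional unital right modules over the `F`-algebra `A`. -/
abbrev FDRightModCat (F : Type k) [Field F] (A : Type v) [NonUnitalRing A] [Module F A] :=
  (RightModCat.isFinDim.{v, k, w} F A).FullSubcategory

/-- The modules over the Laurent polynomial algebra `F[x, x⁻¹]` which are finite dimensional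
over `F`. -/
def isFinDimLaurent (F : Type k) [Field F] :
    ObjectProperty (ModuleCat.{w} (LaurentPolynomial F)) :=
  fun M => Module.Finite F (RestrictScalars F (LaurentPolynomial F) M)

/-- The category of finite dimensional `F[x, x⁻¹]`-modules. -/
abbrev FDLaurentModCat (F : Type k) [Field F] :=
  (isFinDimLaurent.{k, w} F).FullSubcategory

/-- Families of objects of which all but finitely many are zero. -/
def isFinitelySupported {ι : Type*} (C : ι → Type*) [∀ i, Category (C i)] :
    ObjectProperty (∀ i, C i) :=
  fun X => {i | ¬ Limits.IsZero (X i)}.Finite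

/-- The direct sum of a family of categories (with zero objects): the full subcategory of the
product category on the families of which all but finitely many members are zero. -/
abbrev DirectSumCat {ι : Type*} (C : ι → Type*) [∀ i, Category (C i)] :=
  (isFinitelySupported C).FullSubcategory

/-! A module over the Leavitt path algebra is a vector space with operators for vertices, arrows and
ghosts; write `m·p` and `m·p*` for the action of a path `p` and of its ghost. The anchors are the
sinks in $\mathcal{S}$ together with one base vertex on each cycle in $\mathcal{T}$. The equivalence
sends `M` to the spaces `M·v`, `v` an anchor; for a cycle, the variable `x` acts on `M·v` as the
loop `c` at `v`.

Finite dimension enters through `c* c = v`: a one-sided inverse of `c` on `M·v` is two-sided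
(`ghostAct_pathAct`). If `f` leaves a closed path `c` at its base, then `f* c = 0`, hence `M·f* = 0`
and `M·t(f) = M·f*f = 0` (`eq_of_closed`). So cycles have no exits inside the support, which is
finite and closed under predecessors; following arrows within it, one ends at a sink or on a cycle,
and these belong to $\mathcal{S}$ or $\mathcal{T}$ (`exists_anchor_mem`).

It follows that an element `m` is determined by its coordinates `m·p`, where `p` runs over the
anchored paths: those which end at an anchor and avoid the first arrow of the loop there
(`eq_zero_of_anchored`). This gives faithfulness. Each anchor has only finitely many anchored paths,
and `p* q = 0` for distinct ones, so maps `g b` between the parts at the anchors which commute with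
the loops extend to `m ↦ ∑ g b (m·p)·p*` (`exists_extension`). This gives fullness. For essential
surjectivity, functions on anchored paths with values in the given spaces form a module on which
arrows act by shifting, with a twist by the given automorphism whenever the loop closes
(`exists_module_of_family`). -/

namespace DiGraph

/-! ### Paths and cycles as lists of arrows -/

section Paths

variable {V : Type u} {E : Type v} (Γ : DiGraph V E)

/-- The vertex at which a list of arrows starts, where the empty list is placed at `y`. -/
def startOf (y : V) : List E → V
  | [] => y
  | e :: _ => Γ.s e

/-- A list of arrows is a directed path which ends at `y`. -/
def IsPathTo (y : V) : List E → Prop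
  | [] => True
  | e :: p => Γ.t e = Γ.startOf y p ∧ IsPathTo y p

variable {Γ}

@[simp] theorem startOf_nil (y : V) : Γ.startOf y [] = y := rfl

@[simp] theorem startOf_cons (y : V) (e : E) (p : List E) : Γ.startOf y (e :: p) = Γ.s e := rfl

@[simp] theorem isPathTo_nil (y : V) : Γ.IsPathTo y [] := trivial

@[simp] theorem isPathTo_cons (y : V) (e : E) (p : List E) :
    Γ.IsPathTo y (e :: p) ↔ Γ.t e = Γ.startOf y p ∧ Γ.IsPathTo y p := Iff.rfl

theorem startOf_append (y : V) (p q : List E) :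
    Γ.startOf y (p ++ q) = Γ.startOf (Γ.startOf y q) p := by
  cases p <;> rfl

theorem isPathTo_append (y : V) (p q : List E) :
    Γ.IsPathTo y (p ++ q) ↔ Γ.IsPathTo (Γ.startOf y q) p ∧ Γ.IsPathTo y q := by
  induction p with
  | nil => simp
  | cons e p ih => simp [ih, startOf_append, and_assoc]

theorem leads_step (e : E) {y : V} (h : Γ.Leads (Γ.t e) y) : Γ.Leads (Γ.s e) y :=
  Relation.ReflTransGen.head ⟨e, rfl, rfl⟩ h

theorem IsPathTo.leads {y : V} {p : List E} (h : Γ.IsPathTo y p) :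
    Γ.Leads (Γ.startOf y p) y := by
  induction p with
  | nil => exact Relation.ReflTransGen.refl
  | cons e p ih => exact leads_step e (h.1 ▸ ih h.2)

theorem IsPathTo.leads_of_mem {y : V} {p : List E} (h : Γ.IsPathTo y p) {e : E} (he : e ∈ p) :
    Γ.Leads (Γ.startOf y p) (Γ.s e) ∧ Γ.Leads (Γ.t e) y := by
  obtain ⟨a, c, rfl⟩ := List.append_of_mem he
  rw [isPathTo_append] at h
  exact ⟨by simpa [startOf_append] using h.1.leads, h.2.1 ▸ h.2.2.leads⟩

/-- If `x` leads to `y`, some path from `x` to `y` visits no vertex twice. -/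
theorem Leads.exists_simple {x y : V} (h : Γ.Leads x y) :
    ∃ p, Γ.IsPathTo y p ∧ Γ.startOf y p = x ∧ (p.map Γ.s).Nodup ∧ y ∉ p.map Γ.s := by
  induction h using Relation.ReflTransGen.head_induction_on with
  | refl => exact ⟨[], by simp⟩
  | head h _ ih =>
    obtain ⟨e, rfl, rfl⟩ := h
    obtain ⟨p, hp, hs, hn, hy⟩ := ih
    -- If the source of `e` is already visited by `p`, the final segment of `p` from that visit on
    -- is the required path.
    by_cases h1 : Γ.s e ∈ p.map Γ.s
    · obtain ⟨f, hf, hfe⟩ := List.mem_map.1 h1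
      obtain ⟨a, c, rfl⟩ := List.append_of_mem hf
      rw [isPathTo_append] at hp
      rw [List.map_append, List.nodup_append] at hn
      refine ⟨f :: c, hp.2, hfe, hn.2.1, fun h => hy ?_⟩
      rw [List.map_append]
      exact List.mem_append_right _ h
    · by_cases h2 : y = Γ.s e
      · exact ⟨[], by simp [h2]⟩
      · exact ⟨e :: p, ⟨hs.symm, hp⟩, rfl, by simpa using ⟨by simpa using h1, hn⟩, by
          simp only [List.map_cons, List.mem_cons, not_or]; exact ⟨h2, hy⟩⟩

theorem isChain_append_singleton_iff (a : E) (p : List E) :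
    List.IsChain (fun e f => Γ.t e = Γ.s f) (p ++ [a]) ↔ Γ.IsPathTo (Γ.s a) p := by
  induction p with
  | nil => simp
  | cons e p ih =>
    cases p with
    | nil => simp
    | cons f p =>
      rw [List.cons_append] at ih
      simp only [List.cons_append, List.isChain_cons_cons, ih, isPathTo_cons, startOf_cons]

/-- Replaces the rotation class by a closed path with a chosen first arrow, so that path lemmas
apply to cycles. -/
theorem isCycle_cons_iff (e : E) (l : List E) :
    Γ.IsCycle (↑(e :: l) : Cycle E) ↔ Γ.IsPathTo (Γ.s e) (e :: l) ∧ ((e :: l).map Γ.s).Nodup := by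
  rw [IsCycle, Cycle.chain_coe_cons, ← List.cons_append, isChain_append_singleton_iff,
    Cycle.map_coe, Cycle.nodup_coe_iff]
  exact and_iff_right (by simp [← Cycle.coe_nil])

theorem exists_eq_cons_of_mem {C : Cycle E} {e : E} (he : e ∈ C) :
    ∃ l : List E, C = ↑(e :: l) := by
  induction C using Quotient.inductionOn with
  | h p =>
    obtain ⟨a, c, rfl⟩ := List.append_of_mem (Cycle.mem_coe_iff.1 he)
    exact ⟨c ++ a, Cycle.coe_eq_coe.2 List.isRotated_append⟩

/-- An arrow whose target leads back to its source lies on a cycle. -/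
theorem exists_isCycle_of_leads {e : E} (h : Γ.Leads (Γ.t e) (Γ.s e)) :
    ∃ D : Cycle E, Γ.IsCycle D ∧ e ∈ D := by
  obtain ⟨p, hp, hs, hn, hy⟩ := h.exists_simple
  refine ⟨↑(e :: p), (isCycle_cons_iff e p).2 ⟨⟨hs.symm, hp⟩, ?_⟩, by simp⟩
  exact List.nodup_cons.2 ⟨hy, hn⟩

theorem IsCycle.leads {C : Cycle E} (hC : Γ.IsCycle C) {e f : E} (he : e ∈ C) (hf : f ∈ C) :
    Γ.Leads (Γ.t f) (Γ.s e) ∧ Γ.Leads (Γ.s e) (Γ.s f) := by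
  obtain ⟨l, rfl⟩ := exists_eq_cons_of_mem he
  have h := (isCycle_cons_iff e l).1 hC
  exact (h.1.leads_of_mem (Cycle.mem_coe_iff.1 hf)).symm

theorem IsCycle.exists_next {C : Cycle E} (hC : Γ.IsCycle C) {e : E} (he : e ∈ C) :
    ∃ f ∈ C, Γ.s f = Γ.t e := by
  obtain ⟨l, rfl⟩ := exists_eq_cons_of_mem he
  have h := (isCycle_cons_iff e l).1 hC
  cases l with
  | nil => exact ⟨e, he, h.1.1.symm⟩
  | cons f l => exact ⟨f, by simp, h.1.1.symm⟩

/-- Paths with the same ends along which arrows are determined by their sources coincide. -/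
theorem IsPathTo.eq_of_deterministic {y : V} {p q : List E} (hp : Γ.IsPathTo y p)
    (hq : Γ.IsPathTo y q) (h : Γ.startOf y p = Γ.startOf y q) (hyp : y ∉ p.map Γ.s)
    (hyq : y ∉ q.map Γ.s) (hd : ∀ e ∈ p, ∀ f ∈ q, Γ.s e = Γ.s f → e = f) : p = q := by
  induction p generalizing q with
  | nil =>
    cases q with
    | nil => rfl
    | cons f q => simp at h hyq; exact absurd h hyq.1
  | cons e p ih =>
    cases q with
    | nil => simp at h hyp; exact absurd h.symm hyp.1
    | cons f q =>
      obtain rfl : e = f := hd e (by simp) f (by simp) h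
      simp only [List.map_cons, List.mem_cons, not_or] at hyp hyq
      rw [ih hp.2 hq.2 (hp.1.symm.trans hq.1) hyp.2 hyq.2
        fun a ha b hb => hd a (by simp [ha]) b (by simp [hb])]

end Paths

/-! ### Anchors and anchored paths -/

section Anchors

variable {V : Type u} {E : Type v} {Γ : DiGraph V E}

/-- The index set of the right hand side of the classification. -/
abbrev Index (Γ : DiGraph V E) := Γ.finMaximalSinks ⊕ Γ.finMaximalCycles

/-- The empty list at a sink, and a list of arrows which runs once around a cycle. -/
noncomputable def loop : Γ.Index → List E
  | .inl _ => []
  | .inr C => Quot.out C.1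

theorem coe_loop_inr (C : Γ.finMaximalCycles) : (↑(loop (.inr C) : List E) : Cycle E) = C.1 :=
  Quot.out_eq C.1

theorem loop_inr_ne_nil (C : Γ.finMaximalCycles) : loop (.inr C : Γ.Index) ≠ [] := by
  intro h
  have := coe_loop_inr C
  rw [h] at this
  exact C.2.1.1.1 this.symm

/-- The sink itself, or the vertex at which the chosen loop around the cycle starts. -/
noncomputable def anchor : Γ.Index → V
  | .inl x => x.1
  | .inr C => Γ.s ((loop (.inr C : Γ.Index)).head (loop_inr_ne_nil C))

theorem anchor_eq_of_loop {b : Γ.Index} {e : E} {l : List E} (h : loop b = e :: l) :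
    anchor b = Γ.s e := by
  cases b with
  | inl x => simp [loop] at h
  | inr C => simp [anchor, h]

theorem isSink_of_loop_eq_nil {b : Γ.Index} (h : loop b = []) : Γ.IsSink (anchor b) := by
  cases b with
  | inl x => exact x.2.1.1
  | inr C => exact absurd h (loop_inr_ne_nil C)

theorem isCycle_loop {b : Γ.Index} (h : loop b ≠ []) : Γ.IsCycle (↑(loop b) : Cycle E) := by
  cases b with
  | inl x => exact absurd rfl h
  | inr C => rw [coe_loop_inr]; exact C.2.1.1

/-- The form in which maximality is used, uniformly for both kinds of index: for a sink the
hypotheses contradict each other. -/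
theorem eq_loop_of_leads {b : Γ.Index} {D : Cycle E} (hD : Γ.IsCycle D) {e : E} (he : e ∈ D)
    (h : Γ.Leads (Γ.s e) (anchor b)) : D = ↑(loop b) := by
  cases b with
  | inl x => exact absurd h (x.2.1.2 D hD e he)
  | inr C =>
    rw [coe_loop_inr]
    refine C.2.1.2 D hD ⟨e, he, _, ?_, h⟩
    rw [← coe_loop_inr, Cycle.mem_coe_iff]
    exact List.head_mem _

theorem finite_predecessors_anchor (b : Γ.Index) : (Γ.predecessors (anchor b)).Finite := by
  cases b with
  | inl x => exact x.2.2
  | inr C =>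
    refine C.2.2.subset fun y hy => ⟨_, ?_, hy⟩
    rw [← coe_loop_inr, Cycle.mem_coe_iff]
    exact List.head_mem _

theorem eq_of_coe_loop_eq {b b' : Γ.Index} (h : (↑(loop b) : Cycle E) = ↑(loop b'))
    (hne : loop b ≠ []) : b = b' := by
  cases b with
  | inl x => exact absurd rfl hne
  | inr C =>
    cases b' with
    | inl x => exact absurd ((Cycle.coe_eq_nil _).1 h) hne
    | inr C' =>
      rw [coe_loop_inr, coe_loop_inr] at h
      rw [Subtype.ext h]

theorem not_isSink_source (e : E) : ¬ Γ.IsSink (Γ.s e) := fun h =>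
  (Set.eq_empty_iff_forall_notMem.1 h e) rfl

theorem exists_loop_eq_cons {b : Γ.Index} (h : loop b ≠ []) : ∃ e l, loop b = e :: l :=
  List.exists_cons_of_ne_nil h

theorem isPathTo_loop (b : Γ.Index) : Γ.IsPathTo (anchor b) (loop b) := by
  by_cases h : loop b = []
  · simp [h]
  · obtain ⟨e, l, hl⟩ := exists_loop_eq_cons h
    have := isCycle_loop h
    rw [hl, isCycle_cons_iff] at this
    rw [hl, anchor_eq_of_loop hl]
    exact this.1

theorem startOf_loop (b : Γ.Index) : Γ.startOf (anchor b) (loop b) = anchor b := by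
  cases h : loop b with
  | nil => rfl
  | cons e l => exact (anchor_eq_of_loop h).symm

theorem nodup_loop (b : Γ.Index) : ((loop b).map Γ.s).Nodup := by
  by_cases h : loop b = []
  · simp [h]
  · obtain ⟨e, l, hl⟩ := exists_loop_eq_cons h
    have := isCycle_loop h
    rw [hl, isCycle_cons_iff] at this
    rw [hl]
    exact this.2

/-- An index whose anchor leads to another anchor is equal to it. -/
theorem eq_of_leads_anchor {b b' : Γ.Index} (h : Γ.Leads (anchor b') (anchor b)) : b' = b := by
  by_cases hl : loop b' = []
  · have hs := isSink_of_loop_eq_nil hl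
    have hab : anchor b' = anchor b := by
      rcases Relation.ReflTransGen.cases_head h with h | ⟨_, ⟨e, he, _⟩, _⟩
      · exact h
      · exact absurd (he ▸ hs) (not_isSink_source e)
    cases b' with
    | inr C => exact absurd hl (loop_inr_ne_nil C)
    | inl x =>
      cases b with
      | inl y => rw [Subtype.ext hab]
      | inr C => exact absurd (hab ▸ hs) (not_isSink_source _)
  · obtain ⟨e, l, hel⟩ := exists_loop_eq_cons hl
    refine eq_of_coe_loop_eq (eq_loop_of_leads (e := e) (isCycle_loop hl) (by simp [hel]) ?_) hl
    rwa [← anchor_eq_of_loop hel]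

theorem anchor_injective : Function.Injective (anchor : Γ.Index → V) := fun _ _ h =>
  eq_of_leads_anchor (h ▸ Relation.ReflTransGen.refl)

/-- A path which ends at an anchor and does not use the first arrow of the loop there. -/
def IsAnchored (b : Γ.Index) (p : List E) : Prop :=
  Γ.IsPathTo (anchor b) p ∧ ∀ e ∈ p, (loop b).head? ≠ some e

theorem isAnchored_nil (b : Γ.Index) : IsAnchored b [] := ⟨trivial, by simp⟩

theorem IsAnchored.tail {b : Γ.Index} {e : E} {p : List E} (h : IsAnchored b (e :: p)) :
    IsAnchored b p :=
  ⟨h.1.2, fun f hf => h.2 f (List.mem_cons_of_mem _ hf)⟩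

theorem IsAnchored.cons {b : Γ.Index} {e : E} {p : List E} (h : IsAnchored b p)
    (hs : Γ.t e = Γ.startOf (anchor b) p) (he : (loop b).head? ≠ some e) :
    IsAnchored b (e :: p) :=
  ⟨⟨hs, h.1⟩, by rintro f (_ | ⟨_, hf⟩); exacts [he, h.2 f hf]⟩

theorem mem_loop_of_leads {b : Γ.Index} {e : E} (h : Γ.Leads (Γ.t e) (Γ.s e))
    (h' : Γ.Leads (Γ.s e) (anchor b)) : e ∈ loop b := by
  obtain ⟨D, hD, he⟩ := exists_isCycle_of_leads h
  rwa [eq_loop_of_leads hD he h', Cycle.mem_coe_iff] at he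

/-- The only arrows with source on the loop and target leading to the anchor are those of the
loop. -/
theorem mem_loop_of_source_eq {b : Γ.Index} {e c : E} (hc : c ∈ loop b) (hec : Γ.s e = Γ.s c)
    (h : Γ.Leads (Γ.t e) (anchor b)) : e ∈ loop b := by
  refine mem_loop_of_leads (h.trans ?_) (leads_step e h)
  have := ((isPathTo_loop b).leads_of_mem hc).1
  rwa [startOf_loop, ← hec] at this

/-- Anchored paths which start on the loop are the final segments of the loop. -/
theorem IsAnchored.suffix {b : Γ.Index} {e : E} {l p : List E} (hl : loop b = e :: l)
    (hp : IsAnchored b p) (hs : Γ.startOf (anchor b) p ∈ (loop b).map Γ.s) : p <:+ l := by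
  induction p with
  | nil => exact List.nil_suffix
  | cons f p ih =>
    obtain ⟨c, hc, hcf⟩ := List.mem_map.1 hs
    -- `f` starts on the loop and leads back to the anchor, so by maximality it cannot leave the
    -- loop.
    have hf : f ∈ loop b := mem_loop_of_source_eq hc hcf.symm (hp.1.1 ▸ hp.tail.1.leads)
    have hC := isCycle_loop (b := b) (by simp [hl])
    obtain ⟨g, hg, hgf⟩ := hC.exists_next (Cycle.mem_coe_iff.2 hf)
    have h1 := ih hp.tail (by
      rw [← hp.1.1, ← hgf]; exact List.mem_map_of_mem (Cycle.mem_coe_iff.1 hg))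
    have hfe : f ≠ e := by rintro rfl; exact hp.2 f (by simp) (by simp [hl])
    have hfl : f ∈ l := by simpa [hl, hfe] using hf
    obtain ⟨a, d, rfl⟩ := List.append_of_mem hfl
    have hpath : Γ.IsPathTo (anchor b) (e :: (a ++ f :: d)) := hl ▸ isPathTo_loop b
    have h2 := ((isPathTo_append _ _ _).1 hpath.2).2
    have hn := nodup_loop b
    rw [hl, List.map_cons, List.nodup_cons, ← anchor_eq_of_loop hl] at hn
    have hsub : p.Sublist (a ++ f :: d) := h1.sublist
    have hsub' : d.Sublist (a ++ f :: d) :=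
      (List.sublist_cons_self f d).trans (List.sublist_append_right _ _)
    -- Both lists run from the target of `f` to the anchor along arrows of the loop, which are
    -- determined by their sources.
    have : p = d := hp.tail.1.eq_of_deterministic h2.2 (hp.1.1.symm.trans h2.1)
      (fun h => hn.1 ((hsub.map _).subset h)) (fun h => hn.1 ((hsub'.map _).subset h))
      fun x hx y hy hxy => List.inj_on_of_nodup_map hn.2 (hsub.subset hx) (hsub'.subset hy) hxy
    rw [this]
    exact List.suffix_append _ _

/-- The only anchored path which starts at an anchor is the trivial one. -/
theorem IsAnchored.eq_nil {b b' : Γ.Index} {p : List E} (hp : IsAnchored b p)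
    (hs : Γ.startOf (anchor b) p = anchor b') : p = [] ∧ b' = b := by
  obtain rfl := eq_of_leads_anchor (hs ▸ hp.1.leads)
  refine ⟨?_, rfl⟩
  cases hl : loop b' with
  | nil =>
    cases p with
    | nil => rfl
    | cons f p => exact absurd (hs ▸ isSink_of_loop_eq_nil hl) (not_isSink_source f)
  | cons e l =>
    have h := hp.suffix hl (by rw [hs, hl, anchor_eq_of_loop hl]; simp)
    cases p with
    | nil => rfl
    | cons f p =>
      have hn := nodup_loop b'
      rw [hl, List.map_cons, List.nodup_cons, ← anchor_eq_of_loop hl, ← hs] at hn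
      exact absurd (List.mem_map_of_mem (h.subset List.mem_cons_self)) hn.1

/-- The sources on the loop are distinct, so its first arrow does not recur in the tail. -/
theorem isAnchored_tail_loop {b : Γ.Index} {e : E} {l : List E} (hl : loop b = e :: l) :
    IsAnchored b l ∧ Γ.t e = Γ.startOf (anchor b) l := by
  have hpath : Γ.IsPathTo (anchor b) (e :: l) := hl ▸ isPathTo_loop b
  refine ⟨⟨hpath.2, fun f hf hfe => ?_⟩, hpath.1⟩
  have hn := nodup_loop b
  rw [hl, List.map_cons, List.nodup_cons] at hn
  obtain rfl : e = f := by simpa [hl] using hfe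
  exact hn.1 (List.mem_map_of_mem hf)

/-- The rest of the loop is the only anchored path which starts at the target of the first arrow
of the loop. -/
theorem IsAnchored.eq_tail_loop {b : Γ.Index} {e : E} {l p : List E} (hl : loop b = e :: l)
    (hp : IsAnchored b p) (hs : Γ.t e = Γ.startOf (anchor b) p) : p = l := by
  have hC := isCycle_loop (b := b) (by simp [hl])
  obtain ⟨g, hg, hge⟩ := hC.exists_next (e := e) (by simp [hl])
  have hsub := (hp.suffix hl (by
    rw [← hs, ← hge]; exact List.mem_map_of_mem (Cycle.mem_coe_iff.1 hg))).sublist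
  have h2 := isAnchored_tail_loop hl
  have hn := nodup_loop b
  rw [hl, List.map_cons, List.nodup_cons, ← anchor_eq_of_loop hl] at hn
  exact hp.1.eq_of_deterministic h2.1.1 (hs.symm.trans h2.2)
    (fun h => hn.1 ((hsub.map _).subset h)) hn.1
    fun x hx y hy hxy => List.inj_on_of_nodup_map hn.2 (hsub.subset hx) hy hxy

/-- A repeated source puts `e` on a cycle leading to the anchor, hence on the loop. Then `e :: p` is
a suffix of the tail of the loop, where sources do not repeat. -/
theorem IsAnchored.nodup {b : Γ.Index} {p : List E} (hp : IsAnchored b p) :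
    (p.map Γ.s).Nodup := by
  induction p with
  | nil => simp
  | cons e p ih =>
    refine List.nodup_cons.2 ⟨fun hmem => ?_, ih hp.tail⟩
    obtain ⟨f, hf, hfe⟩ := List.mem_map.1 hmem
    have h1 := (hp.tail.1.leads_of_mem hf).1
    rw [← hp.1.1, hfe] at h1
    have he : e ∈ loop b := mem_loop_of_leads h1 hp.1.leads
    obtain ⟨c, l, hl⟩ := exists_loop_eq_cons (List.ne_nil_of_mem he)
    have hsuf := hp.suffix hl (List.mem_map_of_mem he)
    have hn := nodup_loop b
    rw [hl, List.map_cons, List.nodup_cons] at hn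
    exact (List.nodup_cons.1 (hn.2.sublist (hsuf.sublist.map Γ.s))).1 hmem

/-- The arrows available are those emitted by the finitely many predecessors of the anchor, finitely
many by row-finiteness. Since none is repeated, their number bounds the length of the path. -/
theorem finite_isAnchored (hΓ : Γ.RowFinite) (b : Γ.Index) : {p | IsAnchored b p}.Finite := by
  classical
  have hA : {e : E | Γ.Leads (Γ.s e) (anchor b)}.Finite := by
    refine ((finite_predecessors_anchor b).biUnion fun x _ => hΓ x).subset fun e he => ?_
    exact Set.mem_biUnion (show Γ.s e ∈ Γ.predecessors (anchor b) from he) rfl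
  have := hA.to_subtype
  have hfin := List.finite_length_le {e : E | Γ.Leads (Γ.s e) (anchor b)}
    (Nat.card {e : E | Γ.Leads (Γ.s e) (anchor b)})
  refine (hfin.image (List.map Subtype.val)).subset fun p hp => ?_
  have hmem : ∀ e ∈ p, Γ.Leads (Γ.s e) (anchor b) := fun e he =>
    leads_step e (hp.1.leads_of_mem he).2
  lift p to List {e : E | Γ.Leads (Γ.s e) (anchor b)} using hmem
  refine ⟨p, ?_, rfl⟩
  have hnd : p.Nodup := List.Nodup.of_map _ (List.Nodup.of_map _ hp.nodup)
  have := Fintype.ofFinite {e : E | Γ.Leads (Γ.s e) (anchor b)}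
  rw [Nat.card_eq_fintype_card]
  exact hnd.length_le_card

/-- A finite set of vertices which is closed under predecessors, whose non-sinks have successors
in it and on which cycles have no exits contains an anchor unless it is empty. -/
theorem exists_anchor_mem {S : Set V} (hS : S.Finite) (hne : S.Nonempty)
    (hpred : ∀ e, Γ.t e ∈ S → Γ.s e ∈ S)
    (hsucc : ∀ x ∈ S, Γ.IsSink x ∨ ∃ e, Γ.s e = x ∧ Γ.t e ∈ S)
    (hexit : ∀ e f, Γ.s e = Γ.s f → Γ.Leads (Γ.t e) (Γ.s e) → Γ.t f ∈ S → e = f) :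
    ∃ b : Γ.Index, anchor b ∈ S := by
  have hleads : ∀ {x y}, Γ.Leads x y → y ∈ S → x ∈ S := by
    intro x y h hy
    induction h using Relation.ReflTransGen.head_induction_on with
    | refl => exact hy
    | head h _ ih => obtain ⟨e, rfl, rfl⟩ := h; exact hpred e ih
  -- Without exits inside `S`, a path from a cycle into `S` never leaves the cycle.
  have hstay : ∀ {D : Cycle E}, Γ.IsCycle D → ∀ {x y}, Γ.Leads x y → y ∈ S →
      (∃ e ∈ D, Γ.s e = x) → ∃ e ∈ D, Γ.s e = y := by
    intro D hD x y h hy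
    induction h using Relation.ReflTransGen.head_induction_on with
    | refl => exact id
    | head h h' ih =>
      obtain ⟨f, rfl, rfl⟩ := h
      rintro ⟨e, he, hef⟩
      obtain rfl : e = f := hexit e f hef (hD.leads he he).1 (hleads h' hy)
      exact ih (hD.exists_next he)
  have hfp : ∀ {y}, y ∈ S → (Γ.predecessors y).Finite := fun hy =>
    hS.subset fun x hx => hleads hx hy
  by_cases hcyc : ∃ e, Γ.s e ∈ S ∧ Γ.Leads (Γ.t e) (Γ.s e)
  · obtain ⟨e, he, hee⟩ := hcyc
    obtain ⟨C, hC, heC⟩ := exists_isCycle_of_leads hee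
    have hCS : ∀ f ∈ C, Γ.s f ∈ S := fun f hf => hleads (hC.leads hf heC).2 he
    have hmax : Γ.IsMaximalCycle C := by
      refine ⟨hC, ?_⟩
      rintro D hD ⟨d, hd, c, hc, hdc⟩
      obtain ⟨g, hg, hgc⟩ := hstay hD hdc (hCS c hc) ⟨d, hd, rfl⟩
      obtain ⟨c', hc', hcc'⟩ := hC.exists_next hc
      -- The two cycles meet at this vertex, and neither has an exit into `S`; based here they
      -- consist of the same arrows.
      obtain rfl : g = c := hexit g c hgc (hD.leads hg hg).1 (hcc' ▸ hCS c' hc')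
      obtain ⟨l, rfl⟩ := exists_eq_cons_of_mem hg
      obtain ⟨l', rfl⟩ := exists_eq_cons_of_mem hc
      obtain ⟨h1, h2⟩ := (isCycle_cons_iff g l).1 hD
      obtain ⟨h1', h2'⟩ := (isCycle_cons_iff g l').1 hC
      have hll : l = l' := h1.2.eq_of_deterministic h1'.2 (h1.1.symm.trans h1'.1)
        (List.nodup_cons.1 h2).1 (List.nodup_cons.1 h2').1 fun a ha c hc hac => by
          have ha' : a ∈ (↑(g :: l) : Cycle E) := by simp [ha]
          have hc'' : c ∈ (↑(g :: l') : Cycle E) := by simp [hc]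
          obtain ⟨c₁, hc₁, hcc₁⟩ := hC.exists_next hc''
          exact hexit a c hac (hD.leads ha' ha').1 (hcc₁ ▸ hCS c₁ hc₁)
      rw [hll]
    have hCf : (Γ.cyclePredecessors C).Finite := by
      refine (hfp he).subset ?_
      rintro y ⟨f, hf, hyf⟩
      exact Relation.ReflTransGen.trans hyf (hC.leads hf heC).2
    have hCT : C ∈ Γ.finMaximalCycles := ⟨hmax, hCf⟩
    refine ⟨.inr ⟨C, hCT⟩, hCS _ ?_⟩
    have h := List.head_mem (loop_inr_ne_nil ⟨C, hCT⟩)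
    rwa [← Cycle.mem_coe_iff, coe_loop_inr] at h
  · push Not at hcyc
    -- `r x y` says that a nontrivial path leads from `y` to `x`. Without closed paths this is
    -- well-founded on the finite set `S`, and a minimal vertex has no successor in `S`, hence is a
    -- sink.
    let r : S → S → Prop := fun x y => ∃ e, Γ.s e = y ∧ Γ.Leads (Γ.t e) x
    have : Finite S := hS
    have : IsTrans S r := ⟨by
      rintro x y z ⟨e, he, hex⟩ ⟨f, hf, hfy⟩
      exact ⟨f, hf, Relation.ReflTransGen.trans hfy (he ▸ leads_step e hex)⟩⟩
    have : Std.Irrefl r := ⟨by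
      rintro x ⟨e, he, hex⟩
      exact hcyc e (he ▸ x.2) (he ▸ hex)⟩
    obtain ⟨x, -, hx⟩ := (Finite.wellFounded_of_trans_of_irrefl r).has_min Set.univ
      ⟨⟨_, hne.some_mem⟩, trivial⟩
    have hsink : Γ.IsSink x := by
      refine (hsucc x x.2).resolve_right ?_
      rintro ⟨e, he, het⟩
      exact hx ⟨Γ.t e, het⟩ trivial ⟨e, he, Relation.ReflTransGen.refl⟩
    refine ⟨.inl ⟨x, ⟨hsink, fun D hD d hd h => ?_⟩, hfp x.2⟩, x.2⟩
    obtain ⟨g, -, hg⟩ := hstay hD h x.2 ⟨d, hd, rfl⟩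
    exact absurd (hg ▸ hsink) (not_isSink_source g)

end Anchors

end DiGraph

/-! ### Finite dimensional right modules given by operators -/

namespace DiGraph

section RightFamilies

variable {V : Type u} {E : Type v} {Γ : DiGraph V E} {F : Type k} [Field F]
variable {M : Type*} [AddCommGroup M] [Module F M]

variable (Γ) in
/-- A family of linear operators which defines a right module over the Leavitt path algebra. -/
abbrev IsRightLeavitt (R : Gen V E → Module.End F M) : Prop :=
  Γ.IsLeavittFamily fun x => MulOpposite.op (R x)

/-- The right action of a path. -/
def pathAct (R : Gen V E → Module.End F M) : List E → Module.End F M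
  | [] => LinearMap.id
  | e :: p => pathAct R p ∘ₗ R (.arrow e)

/-- The right action of the ghost of a path. -/
def ghostAct (R : Gen V E → Module.End F M) : List E → Module.End F M
  | [] => LinearMap.id
  | e :: p => R (.ghost e) ∘ₗ ghostAct R p

@[simp] theorem pathAct_nil (R : Gen V E → Module.End F M) (m : M) : pathAct R [] m = m := rfl

@[simp] theorem pathAct_cons (R : Gen V E → Module.End F M) (e : E) (p : List E) (m : M) :
    pathAct R (e :: p) m = pathAct R p (R (.arrow e) m) := rfl

@[simp] theorem ghostAct_nil (R : Gen V E → Module.End F M) (m : M) : ghostAct R [] m = m := rfl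

@[simp] theorem ghostAct_cons (R : Gen V E → Module.End F M) (e : E) (p : List E) (m : M) :
    ghostAct R (e :: p) m = R (.ghost e) (ghostAct R p m) := rfl

namespace IsRightLeavitt

variable {R : Gen V E → Module.End F M} (hR : Γ.IsRightLeavitt R)

include hR

theorem vertex_vertex (x : V) (m : M) : R (.vertex x) (R (.vertex x) m) = R (.vertex x) m :=
  LinearMap.congr_fun (MulOpposite.op_injective (hR.vertex_mul_self x)) m

theorem vertex_vertex_of_ne {x y : V} (h : x ≠ y) (m : M) :
    R (.vertex y) (R (.vertex x) m) = 0 :=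
  LinearMap.congr_fun (MulOpposite.op_injective (hR.vertex_mul_of_ne x y h)) m

theorem arrow_vertex (e : E) (m : M) :
    R (.arrow e) (R (.vertex (Γ.s e)) m) = R (.arrow e) m :=
  LinearMap.congr_fun (MulOpposite.op_injective (hR.source_mul_arrow e)) m

theorem vertex_arrow (e : E) (m : M) :
    R (.vertex (Γ.t e)) (R (.arrow e) m) = R (.arrow e) m :=
  LinearMap.congr_fun (MulOpposite.op_injective (hR.arrow_mul_target e)) m

theorem ghost_vertex (e : E) (m : M) :
    R (.ghost e) (R (.vertex (Γ.t e)) m) = R (.ghost e) m :=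
  LinearMap.congr_fun (MulOpposite.op_injective (hR.target_mul_ghost e)) m

theorem vertex_ghost (e : E) (m : M) :
    R (.vertex (Γ.s e)) (R (.ghost e) m) = R (.ghost e) m :=
  LinearMap.congr_fun (MulOpposite.op_injective (hR.ghost_mul_source e)) m

theorem arrow_ghost (e : E) (m : M) :
    R (.arrow e) (R (.ghost e) m) = R (.vertex (Γ.t e)) m :=
  LinearMap.congr_fun (MulOpposite.op_injective (hR.ck1_self e)) m

theorem arrow_ghost_of_ne {e f : E} (h : e ≠ f) (m : M) :
    R (.arrow f) (R (.ghost e) m) = 0 :=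
  LinearMap.congr_fun (MulOpposite.op_injective (hR.ck1_of_ne e f h)) m

theorem vertex_eq_sum {x : V} (h : (Γ.s ⁻¹' {x}).Finite) (hne : (Γ.s ⁻¹' {x}).Nonempty) (m : M) :
    R (.vertex x) m = ∑ e ∈ h.toFinset, R (.ghost e) (R (.arrow e) m) := by
  have := congrArg MulOpposite.unop (hR.ck2 x h hne)
  rw [MulOpposite.unop_op, Finset.unop_sum] at this
  simp [this, LinearMap.sum_apply]

theorem vertex_arrow_of_ne {e : E} {x : V} (h : x ≠ Γ.t e) (m : M) :
    R (.vertex x) (R (.arrow e) m) = 0 := by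
  rw [← hR.vertex_arrow, hR.vertex_vertex_of_ne h.symm]

theorem vertex_ghost_of_ne {e : E} {x : V} (h : x ≠ Γ.s e) (m : M) :
    R (.vertex x) (R (.ghost e) m) = 0 := by
  rw [← hR.vertex_ghost, hR.vertex_vertex_of_ne h.symm]

theorem vertex_pathAct {y : V} {p : List E} (hp : Γ.IsPathTo y p) (m : M) :
    R (.vertex y) (pathAct R p m) = pathAct R p (R (.vertex (Γ.startOf y p)) m) := by
  induction p generalizing m with
  | nil => rfl
  | cons e p ih =>
    rw [pathAct_cons, ih hp.2, ← hp.1, hR.vertex_arrow, pathAct_cons, startOf_cons,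
      hR.arrow_vertex]

theorem vertex_ghostAct {y : V} {p : List E} (hp : Γ.IsPathTo y p) (m : M) :
    R (.vertex (Γ.startOf y p)) (ghostAct R p m) = ghostAct R p (R (.vertex y) m) := by
  induction p with
  | nil => rfl
  | cons e p ih =>
    rw [startOf_cons, ghostAct_cons, hR.vertex_ghost, ghostAct_cons, ← ih hp.2, ← hp.1,
      hR.ghost_vertex]

/-- The relation `e* e = t(e)` iterated along the path. -/
theorem pathAct_ghostAct {y : V} {p : List E} (hp : Γ.IsPathTo y p) (m : M) :
    pathAct R p (ghostAct R p (R (.vertex y) m)) = R (.vertex y) m := by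
  induction p with
  | nil => rfl
  | cons e p ih =>
    rw [ghostAct_cons, pathAct_cons, hR.arrow_ghost, hp.1, hR.vertex_ghostAct hp.2,
      hR.vertex_vertex, ih hp.2]

/-- On a finite dimensional module, closed paths act invertibly. -/
theorem ghostAct_pathAct [Module.Finite F M] {y : V} {p : List E} (hp : Γ.IsPathTo y p)
    (hs : Γ.startOf y p = y) (m : M) :
    ghostAct R p (pathAct R p (R (.vertex y) m)) = R (.vertex y) m := by
  have hP := hR.vertex_pathAct hp
  have hG := hR.vertex_ghostAct hp
  rw [hs] at hP hG
  -- Extending both operators by the identity on the complement of `M·y` gives endomorphisms of `M`,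
  -- where finite dimension turns `X * Y = 1` into `Y * X = 1`.
  let X : Module.End F M := pathAct R p ∘ₗ R (.vertex y) + (1 - R (.vertex y))
  let Y : Module.End F M := ghostAct R p ∘ₗ R (.vertex y) + (1 - R (.vertex y))
  have hXY : X * Y = 1 := by
    ext m
    simp [X, Y, hG, hR.vertex_vertex, hR.pathAct_ghostAct hp]
  have h := LinearMap.congr_fun (mul_eq_one_comm.1 hXY) (R (.vertex y) m)
  simpa [X, Y, hP, hR.vertex_vertex] using h

/-- No arrow which leaves a closed path leads to the support of a finite dimensional module. -/
theorem eq_of_closed [Module.Finite F M] {e f : E} (hef : Γ.s e = Γ.s f)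
    (h : Γ.Leads (Γ.t e) (Γ.s e)) {m : M} (hm : R (.vertex (Γ.t f)) m ≠ 0) : e = f := by
  by_contra hne
  obtain ⟨p, hp, hs, -⟩ := h.exists_simple
  -- The closed path acts injectively at `s(e)`, yet its first arrow `e` kills `m·f*`. Hence `m·f* =
  -- 0` and `m·t(f) = m·f*f = 0`.
  have := hR.ghostAct_pathAct (y := Γ.s e) (p := e :: p) ⟨hs.symm, hp⟩ rfl (R (.ghost f) m)
  rw [pathAct_cons, hR.arrow_vertex, hR.arrow_ghost_of_ne (Ne.symm hne), map_zero, map_zero, hef,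
    hR.vertex_ghost] at this
  exact hm (by rw [← hR.arrow_ghost, ← this, map_zero])

/-- Vertices act as orthogonal idempotents, so nonzero vectors chosen from different `M·x` are
linearly independent. -/
theorem finite_support [Module.Finite F M] : {x | ∃ m, R (.vertex x) m ≠ 0}.Finite := by
  choose m hm using fun x : {x | ∃ m, R (.vertex x) m ≠ 0} => x.2
  have hli : LinearIndependent F fun x => R (.vertex x.1) (m x) := by
    classical
    rw [linearIndependent_iff']
    intro s c hc x hx
    have := congrArg (R (.vertex x.1)) hc
    rw [map_sum, Finset.sum_eq_single x] at this
    · rw [map_smul, hR.vertex_vertex, map_zero] at this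
      exact (smul_eq_zero.1 this).resolve_right (hm x)
    · intro y _ hyx
      rw [map_smul, hR.vertex_vertex_of_ne (fun h => hyx (Subtype.ext h)), smul_zero]
    · exact fun h => absurd hx h
  exact Set.finite_coe_iff.1 hli.finite

/-- An element of a finite dimensional module which is annihilated by all paths to anchors
vanishes. -/
theorem eq_zero_of_anchored [Module.Finite F M] (hΓ : Γ.RowFinite)
    (hN : ∀ m, (∀ x, R (.vertex x) m = 0) → m = 0) {m : M}
    (hm : ∀ (b : Γ.Index) (p : List E), IsAnchored b p →
      R (.vertex (anchor b)) (pathAct R p m) = 0) : m = 0 := by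
  -- `K` is stable under all generators and vanishes at every anchor. If it is nonzero, its support
  -- must contain an anchor, which is a contradiction.
  let K : Set M := {m | ∀ (b : Γ.Index) (p : List E), IsAnchored b p →
      R (.vertex (anchor b)) (pathAct R p m) = 0}
  have hv : ∀ m ∈ K, ∀ x, R (.vertex x) m ∈ K := by
    intro m hm x b p hp
    rw [hR.vertex_pathAct hp.1]
    by_cases h : x = Γ.startOf (anchor b) p
    · rw [h, hR.vertex_vertex, ← hR.vertex_pathAct hp.1, hm b p hp]
    · rw [hR.vertex_vertex_of_ne h, map_zero]
  have ha : ∀ m ∈ K, ∀ e, R (.arrow e) m ∈ K := by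
    intro m hm e b p hp
    -- The first arrow of a loop starts at the anchor, where `m` vanishes by the trivial path; any
    -- other arrow composable with `p` extends it to an anchored path.
    by_cases he : (loop b).head? = some e
    · obtain ⟨l, hl⟩ := List.head?_eq_some_iff.1 he
      rw [hR.vertex_pathAct hp.1]
      by_cases h : Γ.startOf (anchor b) p = Γ.t e
      · rw [h, hR.vertex_arrow, ← hR.arrow_vertex, ← anchor_eq_of_loop hl,
          show R (.vertex (anchor b)) m = 0 from hm b [] (isAnchored_nil b), map_zero, map_zero]
      · rw [hR.vertex_arrow_of_ne h, map_zero]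
    · by_cases h : Γ.startOf (anchor b) p = Γ.t e
      · exact hm b (e :: p) (hp.cons h.symm he)
      · rw [hR.vertex_pathAct hp.1, hR.vertex_arrow_of_ne h, map_zero]
  have hg : ∀ m ∈ K, ∀ e, R (.ghost e) m ∈ K := by
    intro m hm e b p hp
    cases p with
    | cons f p =>
      rw [pathAct_cons]
      by_cases hef : e = f
      · rw [← hef, hR.arrow_ghost]
        exact hv m hm _ b p hp.tail
      · rw [hR.arrow_ghost_of_ne hef, map_zero, map_zero]
    | nil =>
      rw [pathAct_nil]
      by_cases h : anchor b = Γ.s e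
      · cases hl : loop b with
        | nil => exact absurd (h ▸ isSink_of_loop_eq_nil hl) (not_isSink_source e)
        | cons c l =>
          -- The loop `c :: l` acts injectively at the anchor, so it suffices that it kills `m·e*`.
          -- For `e ≠ c` this is `e* c = 0`; for `e = c` what remains is `m·l`, and `l` is anchored.
          have hcl := isAnchored_tail_loop hl
          rw [← hR.ghostAct_pathAct (isPathTo_loop b) (startOf_loop b), h, hR.vertex_ghost, hl,
            pathAct_cons]
          by_cases hec : e = c
          · rw [← hec, hR.arrow_ghost, hec, hcl.2, ← hR.vertex_pathAct hcl.1.1, hm b l hcl.1,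
              map_zero]
          · rw [hR.arrow_ghost_of_ne hec, map_zero, map_zero]
      · rw [hR.vertex_ghost_of_ne h]
  by_contra hne
  obtain ⟨x, hx⟩ : ∃ x, R (.vertex x) m ≠ 0 := by
    by_contra! h
    exact hne (hN m h)
  -- Ghosts carry the support of `K` to predecessors, `ck2` gives every non-sink a successor in it,
  -- and `eq_of_closed` excludes exits.
  obtain ⟨b, k, hk, hbk⟩ := exists_anchor_mem (Γ := Γ) (S := {x | ∃ k ∈ K, R (.vertex x) k ≠ 0})
    (hR.finite_support.subset fun x ⟨k, _, hk⟩ => ⟨k, hk⟩) ⟨x, m, hm, hx⟩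
    (by
      rintro e ⟨k, hk, hke⟩
      refine ⟨_, hg k hk e, fun h => hke ?_⟩
      rw [hR.vertex_ghost] at h
      rw [← hR.arrow_ghost, h, map_zero])
    (by
      rintro x ⟨k, hk, hkx⟩
      refine or_iff_not_imp_left.2 fun hsink => ?_
      rw [hR.vertex_eq_sum (hΓ x) (Set.nonempty_iff_ne_empty.2 hsink)] at hkx
      obtain ⟨e, he, hek⟩ := Finset.exists_ne_zero_of_sum_ne_zero hkx
      refine ⟨e, by simpa using he, _, ha k hk e, fun h => hek ?_⟩
      rw [hR.vertex_arrow] at h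
      rw [h, map_zero])
    (by
      rintro e f hef hee ⟨k, -, hk⟩
      exact hR.eq_of_closed hef hee hk)
  exact hbk (hk b [] (isAnchored_nil b))

/-- Orthogonality `p* q = 0` of distinct anchored paths. Common first arrows cancel; when one path
is exhausted, the rest of the other would be an anchored path starting at an anchor, which is
trivial. -/
theorem pathAct_ghostAct_of_ne {b b' : Γ.Index} {p q : List E} (hp : IsAnchored b p)
    (hq : IsAnchored b' q) (hne : ¬ (b = b' ∧ p = q)) (m : M) :
    R (.vertex (anchor b')) (pathAct R q (ghostAct R p (R (.vertex (anchor b)) m))) = 0 := by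
  induction p generalizing q with
  | nil =>
    rw [hR.vertex_pathAct hq.1, ghostAct_nil]
    by_cases h : anchor b = Γ.startOf (anchor b') q
    · exact absurd ((hq.eq_nil h.symm).imp Eq.symm id).symm hne
    · rw [hR.vertex_vertex_of_ne h, map_zero]
  | cons e p ih =>
    rw [ghostAct_cons]
    cases q with
    | nil =>
      rw [pathAct_nil]
      by_cases h : anchor b' = Γ.s e
      · exact absurd (hp.eq_nil h.symm).1 (by simp)
      · rw [hR.vertex_ghost_of_ne h]
    | cons f q =>
      rw [pathAct_cons]
      by_cases hef : e = f
      · subst hef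
        rw [hR.arrow_ghost, hp.1.1, hR.vertex_ghostAct hp.tail.1, hR.vertex_vertex]
        exact ih hp.tail hq.tail fun h => hne (by simp [h])
      · rw [hR.arrow_ghost_of_ne hef, map_zero, map_zero]

/-- A family of maps between the anchored parts of two finite dimensional modules which commute
with the loops extends to a homomorphism. -/
theorem exists_extension [Module.Finite F M] {N : Type*} [AddCommGroup N] [Module F N]
    [Module.Finite F N] {T : Gen V E → Module.End F N} (hT : Γ.IsRightLeavitt T)
    (hΓ : Γ.RowFinite) (hN : ∀ n, (∀ x, T (.vertex x) n = 0) → n = 0)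
    (g : Γ.Index → M →ₗ[F] N)
    (hg₁ : ∀ b m, T (.vertex (anchor b)) (g b m) = g b m)
    (hg₂ : ∀ b m, g b (R (.vertex (anchor b)) m) = g b m)
    (hg₃ : ∀ b m, g b (pathAct R (loop b) m) = pathAct T (loop b) (g b m)) :
    ∃ f : M →ₗ[F] N, (∀ x m, f (R x m) = T x (f m)) ∧
      ∀ b m, T (.vertex (anchor b)) (f m) = g b m := by
  classical
  have hJ : {b | g b ≠ 0}.Finite := by
    refine (hR.finite_support.preimage anchor_injective.injOn).subset fun b hb => ?_
    by_contra h
    simp only [Set.mem_preimage, Set.mem_ofPred_eq, not_exists, not_not] at h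
    exact hb (LinearMap.ext fun m => by rw [← hg₂, h, map_zero, LinearMap.zero_apply])
  -- The map `m ↦ ∑ g b (m·p)·p*`. By orthogonality, multiplication by an anchored `q` isolates the
  -- summand of `q`, so the coordinates of `f m` are prescribed.
  let f : M →ₗ[F] N := ∑ a ∈ hJ.toFinset.sigma fun b => (finite_isAnchored hΓ b).toFinset,
    ghostAct T a.2 ∘ₗ g a.1 ∘ₗ pathAct R a.2
  have hf : ∀ (b : Γ.Index) (q : List E) (m : M), IsAnchored b q →
      T (.vertex (anchor b)) (pathAct T q (f m)) = g b (pathAct R q m) := by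
    intro b q m hq
    simp only [f, LinearMap.sum_apply, map_sum, LinearMap.comp_apply]
    rw [Finset.sum_eq_single ⟨b, q⟩]
    · dsimp only
      rw [← hg₁, hT.pathAct_ghostAct hq.1, hT.vertex_vertex]
    · rintro ⟨b', p⟩ hbp hne
      simp only [Finset.mem_sigma, Set.Finite.mem_toFinset, Set.mem_ofPred_eq] at hbp
      dsimp only
      rw [← hg₁, hT.pathAct_ghostAct_of_ne hbp.2 hq]
      rintro ⟨rfl, rfl⟩
      exact hne rfl
    · intro h
      simp only [Finset.mem_sigma, Set.Finite.mem_toFinset, Set.mem_ofPred_eq, not_and_or,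
        not_not] at h
      simp [h.resolve_right (not_not_intro hq)]
  have hinj : ∀ n n' : N, (∀ (b : Γ.Index) (q : List E), IsAnchored b q →
      T (.vertex (anchor b)) (pathAct T q n) = T (.vertex (anchor b)) (pathAct T q n')) →
      n = n' := by
    intro n n' h
    refine sub_eq_zero.1 (hT.eq_zero_of_anchored hΓ hN fun b q hq => ?_)
    rw [map_sub, map_sub, h b q hq, sub_self]
  have hv : ∀ x m, f (R (.vertex x) m) = T (.vertex x) (f m) := by
    intro x m
    refine hinj _ _ fun b q hq => ?_
    rw [hf b q _ hq, hT.vertex_pathAct hq.1, ← hg₂, hR.vertex_pathAct hq.1]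
    by_cases h : x = Γ.startOf (anchor b) q
    · rw [h, hT.vertex_vertex, ← hT.vertex_pathAct hq.1, hf b q _ hq, hR.vertex_vertex,
        ← hR.vertex_pathAct hq.1, hg₂]
    · rw [hT.vertex_vertex_of_ne h, hR.vertex_vertex_of_ne h]
      simp
  have hfb : ∀ b m, T (.vertex (anchor b)) (f m) = g b m := fun b m => hf b [] m (isAnchored_nil b)
  have ha : ∀ e m, f (R (.arrow e) m) = T (.arrow e) (f m) := by
    intro e m
    refine hinj _ _ fun b q hq => ?_
    rw [hf b q _ hq]
    by_cases h : Γ.startOf (anchor b) q = Γ.t e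
    · by_cases he : (loop b).head? = some e
      · obtain ⟨l, hl⟩ := List.head?_eq_some_iff.1 he
        obtain rfl := hq.eq_tail_loop hl h.symm
        -- Here `e :: q` is the whole loop rather than an anchored path; this is where compatibility
        -- with the loops is needed.
        rw [← pathAct_cons, ← pathAct_cons, ← hl, hT.vertex_pathAct (isPathTo_loop b),
          startOf_loop, hg₃, hfb]
      · exact (hf b (e :: q) m (hq.cons h.symm he)).symm
    · rw [← hg₂, hR.vertex_pathAct hq.1, hT.vertex_pathAct hq.1, hR.vertex_arrow_of_ne h,
        hT.vertex_arrow_of_ne h]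
      simp
  refine ⟨f, ?_, hfb⟩
  rintro (x | e | e) m
  · exact hv x m
  · exact ha e m
  -- Ghosts come for free: expanding `s(e)` by `ck2` leaves only the term of `e`, so `f(m·e*) =
  -- f(m·e*e)·e* = f(m)·e*`.
  · have hne : (Γ.s ⁻¹' {Γ.s e}).Nonempty := ⟨e, rfl⟩
    rw [← hR.vertex_ghost, hv, hT.vertex_eq_sum (hΓ _) hne, Finset.sum_eq_single e]
    · rw [← ha, hR.arrow_ghost, hv, hT.ghost_vertex]
    · intro e' _ h
      rw [← ha, hR.arrow_ghost_of_ne h.symm, map_zero, map_zero]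
    · intro h
      simp at h

end IsRightLeavitt

end RightFamilies

end DiGraph

/-! ### The branching module -/

namespace DiGraph

variable {V : Type u} {E : Type v} {Γ : DiGraph V E}

theorem IsLeavittFamily.map {B B' G : Type*} [NonUnitalRing B] [NonUnitalRing B'] [FunLike G B B']
    [NonUnitalRingHomClass G B B'] {g : Gen V E → B} (hg : Γ.IsLeavittFamily g) (φ : G) :
    Γ.IsLeavittFamily fun x => φ (g x) where
  vertex_mul_self x := by rw [← map_mul, hg.vertex_mul_self]
  vertex_mul_of_ne x y h := by rw [← map_mul, hg.vertex_mul_of_ne x y h, map_zero]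
  source_mul_arrow e := by rw [← map_mul, hg.source_mul_arrow]
  arrow_mul_target e := by rw [← map_mul, hg.arrow_mul_target]
  target_mul_ghost e := by rw [← map_mul, hg.target_mul_ghost]
  ghost_mul_source e := by rw [← map_mul, hg.ghost_mul_source]
  ck1_self e := by rw [← map_mul, hg.ck1_self]
  ck1_of_ne e f h := by rw [← map_mul, hg.ck1_of_ne e f h, map_zero]
  ck2 x h hne := by simp only [hg.ck2 x h hne, map_sum, map_mul]

section Branching

/-- The paths to an anchor which do not use the first arrow of the loop there. -/
abbrev AnchoredPath (b : Γ.Index) := {p : List E // IsAnchored b p}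

namespace AnchoredPath

variable {b : Γ.Index}

/-- The vertex at which an anchored path starts. -/
noncomputable def start (a : AnchoredPath b) : V := Γ.startOf (anchor b) a.1

variable (b) in
/-- The trivial path at the anchor. -/
noncomputable def nil : AnchoredPath b := ⟨[], isAnchored_nil b⟩

open Classical in
/-- Prepend an arrow to an anchored path; running through the whole loop gives the trivial path. -/
noncomputable def cons (e : E) (a : AnchoredPath b) : AnchoredPath b :=
  -- The trivial path is also a junk value when `e` and `a` do not compose; the lemmas below
  -- therefore assume `a.start = Γ.t e`.
  if h : IsAnchored b (e :: a.1) then ⟨e :: a.1, h⟩ else nil b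

theorem cons_of_isAnchored {e : E} {a : AnchoredPath b} (h : IsAnchored b (e :: a.1)) :
    cons e a = ⟨e :: a.1, h⟩ := dif_pos h

theorem head?_loop_of_not_isAnchored {e : E} {a : AnchoredPath b} (hs : a.start = Γ.t e)
    (h : ¬ IsAnchored b (e :: a.1)) : loop b = e :: a.1 ∧ cons e a = nil b := by
  have he : (loop b).head? = some e := by
    by_contra he
    exact h (a.2.cons hs.symm he)
  obtain ⟨l, hl⟩ := List.head?_eq_some_iff.1 he
  exact ⟨by rw [hl, a.2.eq_tail_loop hl hs.symm], dif_neg h⟩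

theorem start_cons {e : E} {a : AnchoredPath b} (hs : a.start = Γ.t e) :
    (cons e a).start = Γ.s e := by
  by_cases h : IsAnchored b (e :: a.1)
  · rw [cons_of_isAnchored h]; rfl
  · obtain ⟨hl, h⟩ := head?_loop_of_not_isAnchored hs h
    rw [h]
    exact anchor_eq_of_loop hl

/-- Makes the ghost action well defined and yields `e* f = 0`. The trivial path has at most one
preimage, because a wrap-around determines the whole loop. -/
theorem cons_inj {e f : E} {a c : AnchoredPath b} (ha : a.start = Γ.t e) (hc : c.start = Γ.t f)
    (h : cons e a = cons f c) : e = f ∧ a = c := by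
  by_cases h1 : IsAnchored b (e :: a.1) <;> by_cases h2 : IsAnchored b (f :: c.1)
  · rw [cons_of_isAnchored h1, cons_of_isAnchored h2] at h
    have := List.cons.inj (congrArg Subtype.val h)
    exact ⟨this.1, Subtype.ext this.2⟩
  · rw [cons_of_isAnchored h1, (head?_loop_of_not_isAnchored hc h2).2] at h
    exact absurd (congrArg Subtype.val h) (List.cons_ne_nil _ _)
  · rw [cons_of_isAnchored h2, (head?_loop_of_not_isAnchored ha h1).2] at h
    exact absurd (congrArg Subtype.val h).symm (List.cons_ne_nil _ _)
  · have := (head?_loop_of_not_isAnchored ha h1).1.symm.trans (head?_loop_of_not_isAnchored hc h2).1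
    exact ⟨(List.cons.inj this).1, Subtype.ext (List.cons.inj this).2⟩

/-- This is what `ck2` requires: every anchored path from a non-sink, including the trivial one at a
cycle, arises by prepending an arrow. -/
theorem exists_cons (a : AnchoredPath b) (h : ¬ Γ.IsSink a.start) :
    ∃ (e : E) (c : AnchoredPath b), c.start = Γ.t e ∧ cons e c = a := by
  obtain ⟨p, hp⟩ := a
  cases p with
  | cons e p => exact ⟨e, ⟨p, hp.tail⟩, hp.1.1.symm, cons_of_isAnchored hp⟩
  | nil =>
    cases hl : loop b with
    | nil => exact absurd (isSink_of_loop_eq_nil hl) h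
    | cons e l =>
      have ht := isAnchored_tail_loop hl
      exact ⟨e, ⟨l, ht.1⟩, ht.2.symm, dif_neg fun h => h.2 e (by simp) (by simp [hl])⟩

end AnchoredPath

variable {F : Type k} [Field F] (X : Γ.Index → Type w) [∀ b, AddCommGroup (X b)]
  [∀ b, Module F (X b)] (τ : ∀ b, X b ≃ₗ[F] X b)

open Classical in
/-- The automorphism by which an arrow twists the branching module: it is nontrivial for the
first arrow of a loop only. -/
noncomputable def twist (b : Γ.Index) (e : E) : X b ≃ₗ[F] X b :=
  if (loop b).head? = some e then τ b else LinearEquiv.refl F (X b)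

/-- The vector space underlying the branching module. -/
abbrev BranchingModule := ∀ b : Γ.Index, AnchoredPath b → X b

open Classical AnchoredPath in
/-- The action of the generators on the branching module. -/
noncomputable def branching : Gen V E → Module.End F (BranchingModule X)
  | .vertex x => LinearMap.pi fun b => LinearMap.pi fun a =>
      if a.start = x then LinearMap.proj a ∘ₗ LinearMap.proj b else 0
  | .arrow e => LinearMap.pi fun b => LinearMap.pi fun a =>
      -- Elements are functions on anchored paths, and `φ·e` at `a` is the value of `φ` at `ea`,
      -- twisted if `e` opens the loop.
      if a.start = Γ.t e then
        (twist X τ b e).toLinearMap ∘ₗ LinearMap.proj (cons e a) ∘ₗ LinearMap.proj b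
      else 0
  | .ghost e => LinearMap.pi fun b => LinearMap.pi fun a =>
      if h : ∃ c : AnchoredPath b, c.start = Γ.t e ∧ cons e c = a then
        (twist X τ b e).symm.toLinearMap ∘ₗ LinearMap.proj h.choose ∘ₗ LinearMap.proj b
      else 0

variable {X}

open Classical in
theorem branching_vertex (x : V) (φ : BranchingModule X) (b : Γ.Index) (a : AnchoredPath b) :
    branching X τ (.vertex x) φ b a = if a.start = x then φ b a else 0 := by
  simp only [branching, LinearMap.pi_apply]
  split_ifs <;> rfl

open Classical in
theorem branching_arrow (e : E) (φ : BranchingModule X) (b : Γ.Index) (a : AnchoredPath b) :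
    branching X τ (.arrow e) φ b a =
      if a.start = Γ.t e then twist X τ b e (φ b (.cons e a)) else 0 := by
  simp only [branching, LinearMap.pi_apply]
  split_ifs <;> rfl

theorem branching_ghost_cons {e : E} (φ : BranchingModule X) {b : Γ.Index} {a : AnchoredPath b}
    (h : a.start = Γ.t e) :
    branching X τ (.ghost e) φ b (.cons e a) = (twist X τ b e).symm (φ b a) := by
  have hex : ∃ c : AnchoredPath b, c.start = Γ.t e ∧ AnchoredPath.cons e c = .cons e a :=
    ⟨a, h, rfl⟩
  simp only [branching, LinearMap.pi_apply]
  rw [dif_pos hex]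
  simp only [LinearMap.comp_apply, LinearMap.proj_apply, LinearEquiv.coe_coe]
  rw [(AnchoredPath.cons_inj hex.choose_spec.1 h hex.choose_spec.2).2]

theorem branching_ghost_of_forall_ne {e : E} (φ : BranchingModule X) {b : Γ.Index}
    {a : AnchoredPath b} (h : ∀ c : AnchoredPath b, c.start = Γ.t e → .cons e c ≠ a) :
    branching X τ (.ghost e) φ b a = 0 := by
  simp only [branching, LinearMap.pi_apply]
  rw [dif_neg fun ⟨c, hc, hca⟩ => h c hc hca, LinearMap.zero_apply]

theorem op_mul_op_eq {M : Type*} [AddCommGroup M] [Module F M] {A B C : Module.End F M}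
    (h : ∀ m, B (A m) = C m) :
    MulOpposite.op A * MulOpposite.op B = MulOpposite.op C :=
  congrArg MulOpposite.op (LinearMap.ext h)

/-- For a non-sink `x`, the paths starting at `x` are partitioned by the images of the injections
`cons e` with `s(e) = x`, each defined on the paths starting at `t(e)`. -/
theorem isRightLeavitt_branching : Γ.IsRightLeavitt (branching X τ) where
  vertex_mul_self x := by
    refine op_mul_op_eq fun φ => funext fun b => funext fun a => ?_
    simp only [branching_vertex]
    split_ifs <;> rfl
  vertex_mul_of_ne x y hxy := by
    refine op_mul_op_eq (C := 0) fun φ => funext fun b => funext fun a => ?_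
    simp only [branching_vertex]
    split_ifs with h1 h2
    · exact absurd (h2.symm.trans h1) hxy
    · rfl
    · rfl
  source_mul_arrow e := by
    refine op_mul_op_eq fun φ => funext fun b => funext fun a => ?_
    simp only [branching_vertex, branching_arrow]
    split_ifs with h1 h2
    · rfl
    · exact absurd (AnchoredPath.start_cons h1) h2
    · rfl
  arrow_mul_target e := by
    refine op_mul_op_eq fun φ => funext fun b => funext fun a => ?_
    simp only [branching_vertex, branching_arrow]
    split_ifs <;> rfl
  target_mul_ghost e := by
    refine op_mul_op_eq fun φ => funext fun b => funext fun a => ?_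
    by_cases h : ∃ c : AnchoredPath b, c.start = Γ.t e ∧ .cons e c = a
    · obtain ⟨c, hc, rfl⟩ := h
      rw [branching_ghost_cons τ _ hc, branching_ghost_cons τ _ hc, branching_vertex, if_pos hc]
    · push Not at h
      rw [branching_ghost_of_forall_ne τ _ h, branching_ghost_of_forall_ne τ _ h]
  ghost_mul_source e := by
    refine op_mul_op_eq fun φ => funext fun b => funext fun a => ?_
    simp only [branching_vertex]
    split_ifs with h1
    · rfl
    · refine (branching_ghost_of_forall_ne τ _ fun c hc h => h1 ?_).symm
      rw [← h, AnchoredPath.start_cons hc]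
  ck1_self e := by
    refine op_mul_op_eq fun φ => funext fun b => funext fun a => ?_
    simp only [branching_vertex, branching_arrow]
    split_ifs with h1
    · rw [branching_ghost_cons τ _ h1, LinearEquiv.apply_symm_apply]
    · rfl
  ck1_of_ne e f hef := by
    refine op_mul_op_eq (C := 0) fun φ => funext fun b => funext fun a => ?_
    simp only [branching_arrow]
    split_ifs with h1
    · rw [branching_ghost_of_forall_ne τ _ fun c hc h => hef (AnchoredPath.cons_inj hc h1 h).1,
        map_zero]
      rfl
    · rfl
  ck2 x hx hne := by
    simp only [← MulOpposite.op_mul]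
    rw [← Finset.op_sum]
    refine congrArg MulOpposite.op (LinearMap.ext fun φ => funext fun b => funext fun a => ?_)
    simp only [LinearMap.sum_apply, Finset.sum_apply, Module.End.mul_apply, branching_vertex]
    split_ifs with h
    · obtain ⟨e, c, hc, rfl⟩ := a.exists_cons (by
        rw [h]; exact Set.nonempty_iff_ne_empty.1 hne)
      rw [Finset.sum_eq_single e]
      · rw [branching_ghost_cons τ _ hc, branching_arrow, if_pos hc, LinearEquiv.symm_apply_apply]
      · intro f _ hfe
        exact branching_ghost_of_forall_ne τ _ fun d hd h => hfe (AnchoredPath.cons_inj hd hc h).1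
      · intro hn
        rw [AnchoredPath.start_cons hc] at h
        exact absurd (by simpa using h) hn
    · refine (Finset.sum_eq_zero fun e he => ?_).symm
      refine branching_ghost_of_forall_ne τ _ fun c hc hca => h ?_
      rw [← hca, AnchoredPath.start_cons hc]
      simpa using he

/-- No twist occurs, since an anchored path avoids the first arrow of the loop. The induction needs
a general end segment `r` instead of the trivial path. -/
theorem pathAct_branching {b : Γ.Index} {p : List E} (hp : IsAnchored b p)
    (φ : BranchingModule X) : pathAct (branching X τ) p φ b (.nil b) = φ b ⟨p, hp⟩ := by
  suffices h : ∀ (p r : List E) (hpr : IsAnchored b (p ++ r)) (hr : IsAnchored b r)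
      (φ : BranchingModule X), pathAct (branching X τ) p φ b ⟨r, hr⟩ = φ b ⟨p ++ r, hpr⟩ by
    refine (h p [] (by simpa using hp) (isAnchored_nil b) φ).trans ?_
    congr 1
    exact Subtype.ext (List.append_nil p)
  intro p
  induction p with
  | nil => intro r _ _ φ; rfl
  | cons e p ih =>
    intro r hpr hr φ
    rw [pathAct_cons, ih r hpr.tail hr, branching_arrow,
      if_pos (show AnchoredPath.start ⟨p ++ r, hpr.tail⟩ = Γ.t e from hpr.1.1.symm),
      AnchoredPath.cons_of_isAnchored hpr, twist, if_neg (hpr.2 e (by simp))]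
    rfl

theorem pathAct_loop_branching {b : Γ.Index} (hτ : loop b = [] → τ b = LinearEquiv.refl F (X b))
    (φ : BranchingModule X) :
    pathAct (branching X τ) (loop b) φ b (.nil b) = τ b (φ b (.nil b)) := by
  cases hl : loop b with
  | nil => rw [hτ hl]; rfl
  | cons e l =>
    have ht := isAnchored_tail_loop hl
    rw [pathAct_cons, pathAct_branching τ ht.1, branching_arrow,
      if_pos (show AnchoredPath.start ⟨l, ht.1⟩ = Γ.t e from ht.2.symm), twist,
      if_pos (by simp [hl])]
    congr 2
    exact dif_neg fun h => h.2 e (by simp) (by simp [hl])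

open Classical in
/-- A vector at an anchor as an element of the branching module. -/
noncomputable def anchorEmb (b : Γ.Index) : X b →ₗ[F] BranchingModule X :=
  LinearMap.single F (fun b => AnchoredPath b → X b) b ∘ₗ
    LinearMap.single F (fun _ => X b) (AnchoredPath.nil b)

theorem anchorEmb_nil (b : Γ.Index) (x : X b) :
    anchorEmb (F := F) b x b (.nil b) = x := by
  simp [anchorEmb]

theorem anchorEmb_eq (b : Γ.Index) (φ : BranchingModule X) :
    anchorEmb (F := F) b (φ b (.nil b)) = branching X τ (.vertex (anchor b)) φ := by
  classical
  ext b' a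
  rw [branching_vertex]
  split_ifs with h
  · obtain ⟨h1, rfl⟩ := a.2.eq_nil h
    obtain rfl : a = .nil b := Subtype.ext h1
    exact anchorEmb_nil b _
  · by_cases hb : b' = b
    · subst hb
      have : a ≠ .nil b' := fun ha => h (ha ▸ rfl)
      simp [anchorEmb, this]
    · simp [anchorEmb, hb]

/-- Restriction to the finitely many nonzero `X b` embeds the module in a finite product. Smallness
lets it be moved to the universe of the `X b`, although the index type may live elsewhere. -/
theorem finite_branchingModule [∀ b, Module.Finite F (X b)] (hΓ : Γ.RowFinite)
    (hX : {b | Nontrivial (X b)}.Finite) :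
    Module.Finite F (BranchingModule X) ∧ Small.{w} (BranchingModule X) := by
  have := hX.to_subtype
  have : ∀ b : Γ.Index, Finite (AnchoredPath b) := fun b => finite_isAnchored hΓ b
  let r : BranchingModule X →ₗ[F] ∀ b : {b | Nontrivial (X b)}, AnchoredPath b.1 → X b.1 :=
    LinearMap.pi fun b => LinearMap.proj b.1
  have hr : Function.Injective r := by
    intro φ ψ h
    ext b a
    by_cases hb : Nontrivial (X b)
    · exact congrFun (congrFun h ⟨b, hb⟩) a
    · rw [not_nontrivial_iff_subsingleton] at hb
      exact Subsingleton.elim _ _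
  exact ⟨Module.Finite.of_injective r hr, small_of_injective hr⟩

theorem exists_sum_branching (hΓ : Γ.RowFinite) (hX : {b | Nontrivial (X b)}.Finite) :
    ∃ S : Finset V, ∀ φ : BranchingModule X, ∑ x ∈ S, branching X τ (.vertex x) φ = φ := by
  classical
  have hS : (⋃ b ∈ {b | Nontrivial (X b)}, Set.range (AnchoredPath.start (b := b))).Finite := by
    refine hX.biUnion fun b _ => ?_
    have : Finite (AnchoredPath b) := finite_isAnchored hΓ b
    exact Set.finite_range _
  refine ⟨hS.toFinset, fun φ => funext fun b => funext fun a => ?_⟩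
  by_cases hb : Nontrivial (X b)
  · simp only [Finset.sum_apply, branching_vertex]
    rw [Finset.sum_ite_eq, if_pos]
    rw [Set.Finite.mem_toFinset]
    exact Set.mem_biUnion (show b ∈ {b | Nontrivial (X b)} from hb) ⟨a, rfl⟩
  · rw [not_nontrivial_iff_subsingleton] at hb
    exact Subsingleton.elim _ _

/-- Every finitely supported family of spaces with automorphisms comes from a module. -/
theorem exists_module_of_family [∀ b, Module.Finite F (X b)] (hΓ : Γ.RowFinite)
    (hX : {b | Nontrivial (X b)}.Finite)
    (hτ : ∀ b, loop b = [] → τ b = LinearEquiv.refl F (X b)) :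
    ∃ (M : Type w) (_ : AddCommGroup M) (_ : Module F M) (R : Gen V E → Module.End F M),
      Module.Finite F M ∧ Γ.IsRightLeavitt R ∧
      (∃ S : Finset V, ∀ m, ∑ x ∈ S, R (.vertex x) m = m) ∧
      ∃ (p : ∀ b, M →ₗ[F] X b) (i : ∀ b, X b →ₗ[F] M), ∀ b, (∀ x, p b (i b x) = x) ∧
        (∀ m, i b (p b m) = R (.vertex (anchor b)) m) ∧
        ∀ m, p b (pathAct R (loop b) m) = τ b (p b m) := by
  obtain ⟨h1, h2⟩ := finite_branchingModule (F := F) hΓ hX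
  obtain ⟨S, hS⟩ := exists_sum_branching τ hΓ hX
  let ε : BranchingModule X ≃ₗ[F] Shrink.{w} (BranchingModule X) := (Shrink.linearEquiv F _).symm
  let R : Gen V E → Module.End F (Shrink.{w} (BranchingModule X)) :=
    fun x => ε.conjRingEquiv (branching X τ x)
  have hR : ∀ x φ, R x (ε φ) = ε (branching X τ x φ) := fun x φ => by
    simp [R, LinearEquiv.conjRingEquiv]
  have hRp : ∀ p φ, pathAct R p (ε φ) = ε (pathAct (branching X τ) p φ) := by
    intro p
    induction p with
    | nil => intro φ; rfl
    | cons e p ih => intro φ; rw [pathAct_cons, hR, ih, pathAct_cons]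
  refine ⟨_, _, _, R, Module.Finite.equiv ε,
    (isRightLeavitt_branching τ).map (RingEquiv.op ε.conjRingEquiv), ⟨S, fun m => ?_⟩,
    fun b => LinearMap.proj (AnchoredPath.nil b) ∘ₗ LinearMap.proj b ∘ₗ ε.symm.toLinearMap,
    fun b => ε.toLinearMap ∘ₗ anchorEmb b, fun b => ⟨fun x => ?_, fun m => ?_, fun m => ?_⟩⟩
  · obtain ⟨φ, rfl⟩ := ε.surjective m
    simp only [hR]
    rw [← map_sum, hS]
  · simp [anchorEmb_nil]
  · obtain ⟨φ, rfl⟩ := ε.surjective m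
    simp [hR, anchorEmb_eq τ]
  · obtain ⟨φ, rfl⟩ := ε.surjective m
    simp [hRp, pathAct_loop_branching τ (hτ b)]

end Branching

end DiGraph

/-! ### Modules over the Laurent polynomials -/

section Laurent

open LaurentPolynomial

variable {F : Type k} [Field F]

/-- An additive map between modules over the Laurent polynomials which commutes with the scalars
and with the variable is linear. -/
theorem LaurentPolynomial.map_smul_of_T {A B : Type*} [AddCommGroup A] [AddCommGroup B]
    [Module F[T;T⁻¹] A] [Module F[T;T⁻¹] B] (f : A →+ B)
    (hC : ∀ (a : F) x, f ((C a : F[T;T⁻¹]) • x) = (C a : F[T;T⁻¹]) • f x)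
    (hT : ∀ x, f ((T 1 : F[T;T⁻¹]) • x) = (T 1 : F[T;T⁻¹]) • f x) (p : F[T;T⁻¹]) (x : A) :
    f (p • x) = p • f x := by
  have hT' : ∀ x, f ((T (-1) : F[T;T⁻¹]) • x) = (T (-1) : F[T;T⁻¹]) • f x := by
    intro x
    have h := hT ((T (-1) : F[T;T⁻¹]) • x)
    rw [smul_smul, ← T_add] at h
    rw [show (1 : ℤ) + -1 = 0 by norm_num, T_zero, one_smul] at h
    rw [h, smul_smul, ← T_add, show (-1 : ℤ) + 1 = 0 by norm_num, T_zero, one_smul]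
  induction p using LaurentPolynomial.induction_on generalizing x with
  | h_C a => exact hC a x
  | h_add hp hq => rw [add_smul, map_add, hp, hq, add_smul]
  | h_C_mul_T n a h => rw [T_add, ← mul_assoc, mul_smul, h, hT, ← mul_smul]
  | h_C_mul_T_Z n a h => rw [sub_eq_add_neg, T_add, ← mul_assoc, mul_smul, h, hT', ← mul_smul]

/-- A vector space on which the Laurent polynomials act through an automorphism. -/
@[nolint unusedArguments]
def LaurentOn {X : Type w} [AddCommGroup X] [Module F X] (_ : (Module.End F X)ˣ) : Type w := X

namespace LaurentOn

variable {X : Type w} [AddCommGroup X] [Module F X] (τ : (Module.End F X)ˣ)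

instance : AddCommGroup (LaurentOn τ) := inferInstanceAs (AddCommGroup X)

/-- The action of the Laurent polynomials through an automorphism. -/
noncomputable def action : F[T;T⁻¹] →ₐ[F] Module.End F X :=
  AddMonoidAlgebra.lift F _ ℤ ((Units.coeHom _).comp (zpowersHom _ τ))

theorem action_C (a : F) : action τ (C a) = algebraMap F _ a := by
  rw [C_eq_algebraMap, AlgHom.commutes]

theorem action_T : action τ (T 1) = τ := by
  rw [action, T, AddMonoidAlgebra.lift_single]
  simp

noncomputable instance : Module F[T;T⁻¹] (LaurentOn τ) :=
  letI : Module (Module.End F X) (LaurentOn τ) := inferInstanceAs (Module (Module.End F X) X)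
  Module.compHom (LaurentOn τ) (action τ).toRingHom

/-- The identity map to the module over the Laurent polynomials. -/
def of : X ≃+ LaurentOn τ := AddEquiv.refl X

theorem smul_of (p : F[T;T⁻¹]) (x : X) : p • of τ x = of τ (action τ p x) := rfl

theorem C_smul_of (a : F) (x : X) : (C a : F[T;T⁻¹]) • of τ x = of τ (a • x) := by
  rw [smul_of, action_C]
  rfl

theorem T_smul_of (x : X) : (T 1 : F[T;T⁻¹]) • of τ x = of τ (τ.1 x) := by
  rw [smul_of, action_T]

theorem finite [Module.Finite F X] :
    Module.Finite F (RestrictScalars F F[T;T⁻¹] (LaurentOn τ)) := by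
  let f : X →ₗ[F] RestrictScalars F F[T;T⁻¹] (LaurentOn τ) :=
    { toFun := fun x => (RestrictScalars.addEquiv F F[T;T⁻¹] _).symm (of τ x)
      map_add' := fun x y => by simp
      map_smul' := fun a x => by
        apply (RestrictScalars.addEquiv F F[T;T⁻¹] (LaurentOn τ)).injective
        rw [RingHom.id_apply, RestrictScalars.addEquiv_map_smul, ← C_eq_algebraMap]
        simp [C_smul_of] }
  refine Module.Finite.of_surjective f fun y => ?_
  exact ⟨(of τ).symm (RestrictScalars.addEquiv F F[T;T⁻¹] _ y), by simp [f]⟩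

end LaurentOn

end Laurent

/-! ### Zero objects of full subcategories -/

section ZeroObjects

theorem CategoryTheory.ObjectProperty.isZero_of_isZero_obj {C : Type*} [Category C]
    {P : ObjectProperty C} {X : P.FullSubcategory} (h : Limits.IsZero X.obj) :
    Limits.IsZero X where
  unique_to Y := ⟨⟨⟨ObjectProperty.homMk (h.to_ Y.obj)⟩, fun _ =>
    ObjectProperty.hom_ext _ (h.eq_of_src _ _)⟩⟩
  unique_from Y := ⟨⟨⟨ObjectProperty.homMk (h.from_ Y.obj)⟩, fun _ =>
    ObjectProperty.hom_ext _ (h.eq_of_tgt _ _)⟩⟩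

/-- The zero endomorphism lies in any full subcategory, so it equals the identity there; `P` need
not contain a zero module. -/
theorem ModuleCat.subsingleton_of_isZero_fullSubcategory {A : Type*} [Ring A]
    {P : ObjectProperty (ModuleCat.{w} A)} {X : P.FullSubcategory} (h : Limits.IsZero X) :
    Subsingleton X.obj := by
  have h0 : 𝟙 X = ObjectProperty.homMk (0 : X.obj ⟶ X.obj) := h.eq_of_src _ _
  have h1 : 𝟙 X.obj = 0 := congrArg InducedCategory.Hom.hom h0
  refine subsingleton_of_forall_eq 0 fun x => ?_
  exact LinearMap.congr_fun (congrArg ModuleCat.Hom.hom h1) x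

end ZeroObjects

/-! ### Modules over the Leavitt path algebra and their parts at anchors -/

namespace DiGraph

open RightModCat

variable {V : Type u} {E : Type v} {Γ : DiGraph V E} {F : Type k} [Field F]

theorem LeavittPathAlgebra.induction {P : LeavittPathAlgebra F Γ → Prop}
    (gen : ∀ x, P (LeavittPathAlgebra.gen F Γ x)) (add : ∀ a b, P a → P b → P (a + b))
    (zero : P 0) (mul : ∀ a b, P a → P b → P (a * b)) (smul : ∀ (r : F) a, P a → P (r • a))
    (a : LeavittPathAlgebra F Γ) : P a := by
  obtain ⟨a, ha⟩ := a
  induction ha using NonUnitalAlgebra.adjoin_induction with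
  | mem x hx => obtain ⟨y, rfl⟩ := hx; exact gen y
  | add x y hx hy h1 h2 => exact add ⟨x, hx⟩ ⟨y, hy⟩ h1 h2
  | zero => exact zero
  | mul x y hx hy h1 h2 => exact mul ⟨x, hx⟩ ⟨y, hy⟩ h1 h2
  | smul r x hx h => exact smul r ⟨x, hx⟩ h

section Modules

variable (M N : RightModCat.{max u v k, k, w} F (LeavittPathAlgebra F Γ))

/-- The operators by which the generators act on a right module. -/
def genAct (x : Gen V E) : Module.End F M := (M.act (LeavittPathAlgebra.gen F Γ x)).unop

theorem isRightLeavitt_genAct : Γ.IsRightLeavitt (genAct M) :=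
  (isLeavittFamily_gen F Γ).map M.act

variable {M N} in
theorem map_act_of_genAct (f : M →ₗ[F] N) (hf : ∀ x m, f (genAct M x m) = genAct N x (f m))
    (a : LeavittPathAlgebra F Γ) (m : M) : f ((M.act a).unop m) = (N.act a).unop (f m) := by
  induction a using LeavittPathAlgebra.induction generalizing m with
  | gen x => exact hf x m
  | add a b ha hb => simp [ha, hb]
  | zero => simp
  | mul a b ha hb => simp [ha, hb]
  | smul r a ha => simp [ha]

theorem act_mem_span (a : LeavittPathAlgebra F Γ) (m : M) : (M.act a).unop m ∈
    Submodule.span F {m : M | ∃ x n, genAct M (.vertex x) n = m} := by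
  have hM := isRightLeavitt_genAct M
  induction a using LeavittPathAlgebra.induction generalizing m with
  | gen x =>
    refine Submodule.subset_span ?_
    cases x with
    | vertex x => exact ⟨x, m, rfl⟩
    | arrow e => exact ⟨Γ.t e, _, hM.vertex_arrow e m⟩
    | ghost e => exact ⟨Γ.s e, _, hM.vertex_ghost e m⟩
  | add a b ha hb => simpa using Submodule.add_mem _ (ha m) (hb m)
  | zero => simp
  | mul a b ha hb => simpa using hb _
  | smul r a ha => simpa using Submodule.smul_mem _ r (ha m)

/-- Unitality makes the spaces `M·x` span `M`, so the sum of the finitely many vertices in the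
support acts as the identity. -/
theorem eq_zero_of_vertex [Module.Finite F M] (m : M)
    (hm : ∀ x, genAct M (.vertex x) m = 0) : m = 0 := by
  classical
  have hM := isRightLeavitt_genAct M
  have hsum : ∑ x ∈ hM.finite_support.toFinset, genAct M (.vertex x) = 1 := by
    refine LinearMap.ext_on (s := {m : M | ∃ x n, genAct M (.vertex x) n = m}) ?_ ?_
    · rw [eq_top_iff, ← M.unital, Submodule.span_le]
      rintro _ ⟨m, a, rfl⟩
      exact act_mem_span M a m
    · rintro _ ⟨x, n, rfl⟩
      rw [LinearMap.sum_apply, Finset.sum_eq_single x]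
      · exact hM.vertex_vertex x n
      · exact fun y _ h => hM.vertex_vertex_of_ne h.symm n
      · intro h
        simp only [Set.Finite.mem_toFinset, Set.mem_ofPred_eq, not_exists, not_not] at h
        rw [h n, map_zero]
  have := LinearMap.congr_fun hsum m
  rw [LinearMap.sum_apply, Finset.sum_eq_zero fun x _ => hm x] at this
  exact this.symm

/-- A right module over the Leavitt path algebra from operators that satisfy the relations. -/
theorem exists_genAct_eq {M : Type w} [AddCommGroup M] [Module F M]
    {R : Gen V E → Module.End F M} (hR : Γ.IsRightLeavitt R) {S : Finset V}
    (hS : ∀ m, ∑ x ∈ S, R (.vertex x) m = m) :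
    ∃ act : LeavittPathAlgebra F Γ →ₙₐ[F] (Module.End F M)ᵐᵒᵖ,
      (∀ x, (act (LeavittPathAlgebra.gen F Γ x)).unop = R x) ∧
      Submodule.span F {x : M | ∃ (m : M) (a : _), x = (act a).unop m} = ⊤ := by
  obtain ⟨act, hact, -⟩ := LeavittPathAlgebra.existsUnique_lift F Γ _ hR
  have hact' : ∀ x, (act (LeavittPathAlgebra.gen F Γ x)).unop = R x := fun x => by rw [hact]; rfl
  refine ⟨act, hact', eq_top_iff.2 fun m _ => ?_⟩
  rw [← hS m]
  exact Submodule.sum_mem _ fun x _ => Submodule.subset_span ⟨m, _, by rw [hact']⟩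

/-- The part of a module at an anchor. -/
noncomputable def corner (b : Γ.Index) : Submodule F M :=
  LinearMap.range (genAct M (.vertex (anchor b)))

theorem genAct_of_mem_corner {b : Γ.Index} {m : M} (hm : m ∈ corner M b) :
    genAct M (.vertex (anchor b)) m = m := by
  obtain ⟨n, rfl⟩ := hm
  exact (isRightLeavitt_genAct M).vertex_vertex _ n

/-- The projection of a module to its part at an anchor. -/
noncomputable def toCorner (b : Γ.Index) : M →ₗ[F] corner M b :=
  (genAct M (.vertex (anchor b))).codRestrict _ fun m => ⟨m, rfl⟩

theorem coe_toCorner (b : Γ.Index) (m : M) :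
    (toCorner M b m : M) = genAct M (.vertex (anchor b)) m := rfl

theorem toCorner_coe (b : Γ.Index) (m : corner M b) : toCorner M b m = m :=
  Subtype.ext (genAct_of_mem_corner M m.2)

theorem toCorner_genAct (b : Γ.Index) (m : M) :
    toCorner M b (genAct M (.vertex (anchor b)) m) = toCorner M b m :=
  Subtype.ext ((isRightLeavitt_genAct M).vertex_vertex _ m)

theorem pathAct_loop_mem_corner (b : Γ.Index) (m : M) (hm : m ∈ corner M b) :
    pathAct (genAct M) (loop b) m ∈ corner M b := by
  refine ⟨pathAct (genAct M) (loop b) m, ?_⟩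
  rw [(isRightLeavitt_genAct M).vertex_pathAct (isPathTo_loop b), startOf_loop,
    genAct_of_mem_corner M hm]

theorem ghostAct_loop_mem_corner (b : Γ.Index) (m : M) (hm : m ∈ corner M b) :
    ghostAct (genAct M) (loop b) m ∈ corner M b := by
  refine ⟨ghostAct (genAct M) (loop b) m, ?_⟩
  have := (isRightLeavitt_genAct M).vertex_ghostAct (isPathTo_loop b) m
  rwa [startOf_loop, genAct_of_mem_corner M hm] at this

/-- The automorphism of the part of a module at an anchor which is given by the loop there. -/
noncomputable def loopUnit [Module.Finite F M] (b : Γ.Index) : (Module.End F (corner M b))ˣ where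
  val := (pathAct (genAct M) (loop b)).restrict (pathAct_loop_mem_corner M b)
  inv := (ghostAct (genAct M) (loop b)).restrict (ghostAct_loop_mem_corner M b)
  val_inv := LinearMap.ext fun m => Subtype.ext <| by
    have := (isRightLeavitt_genAct M).pathAct_ghostAct (isPathTo_loop b) m.1
    rwa [genAct_of_mem_corner M m.2] at this
  inv_val := LinearMap.ext fun m => Subtype.ext <| by
    have := (isRightLeavitt_genAct M).ghostAct_pathAct (isPathTo_loop b) (startOf_loop b) m.1
    rwa [genAct_of_mem_corner M m.2] at this

theorem loopUnit_toCorner [Module.Finite F M] (b : Γ.Index) (m : M) :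
    (loopUnit M b).1 (toCorner M b m) = toCorner M b (pathAct (genAct M) (loop b) m) := by
  refine Subtype.ext ?_
  have := (isRightLeavitt_genAct M).vertex_pathAct (isPathTo_loop b) m
  rw [startOf_loop] at this
  exact this.symm

theorem coe_loopUnit [Module.Finite F M] (b : Γ.Index) (m : corner M b) :
    ((loopUnit M b).1 m : M) = pathAct (genAct M) (loop b) m := rfl

variable {M N}

theorem _root_.RightModCat.Hom.map_genAct (f : RightModCat.Hom M N) (x : Gen V E) (m : M) :
    f.toLin (genAct M x m) = genAct N x (f.toLin m) := f.map_act _ m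

theorem _root_.RightModCat.Hom.map_pathAct (f : RightModCat.Hom M N) (p : List E) (m : M) :
    f.toLin (pathAct (genAct M) p m) = pathAct (genAct N) p (f.toLin m) := by
  induction p generalizing m with
  | nil => rfl
  | cons e p ih => rw [pathAct_cons, ih, f.map_genAct, pathAct_cons]

/-- The map induced by a homomorphism on the parts at an anchor. -/
noncomputable def cornerMap (f : RightModCat.Hom M N) (b : Γ.Index) : corner M b →ₗ[F] corner N b :=
  f.toLin.restrict fun m hm => ⟨f.toLin m, by rw [← f.map_genAct, genAct_of_mem_corner M hm]⟩

theorem coe_cornerMap (f : RightModCat.Hom M N) (b : Γ.Index) (m : corner M b) :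
    (cornerMap f b m : N) = f.toLin m := rfl

theorem cornerMap_loopUnit [Module.Finite F M] [Module.Finite F N] (f : RightModCat.Hom M N)
    (b : Γ.Index) (m : corner M b) :
    cornerMap f b ((loopUnit M b).1 m) = (loopUnit N b).1 (cornerMap f b m) :=
  Subtype.ext <| by rw [coe_cornerMap, coe_loopUnit, coe_loopUnit, f.map_pathAct, coe_cornerMap]

/-- An anchored path carries `f m - g m` into a part at an anchor, where `f` and `g` agree;
`eq_zero_of_anchored` concludes. -/
theorem hom_ext_of_cornerMap [Module.Finite F N] (hΓ : Γ.RowFinite) {f g : RightModCat.Hom M N}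
    (h : ∀ b : Γ.Index, cornerMap f b = cornerMap g b) : f = g := by
  have hM := isRightLeavitt_genAct M
  refine RightModCat.Hom.ext (LinearMap.ext fun m => sub_eq_zero.1 ?_)
  refine (isRightLeavitt_genAct N).eq_zero_of_anchored hΓ (eq_zero_of_vertex N) fun b p _ => ?_
  have := congrArg Subtype.val (LinearMap.congr_fun (h b) (toCorner M b (pathAct (genAct M) p m)))
  rw [coe_cornerMap, coe_cornerMap, coe_toCorner] at this
  rw [map_sub, map_sub, ← f.map_pathAct, ← f.map_genAct, ← g.map_pathAct, ← g.map_genAct, this,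
    sub_self]

/-- Compatibility is asked for at cycles only, because the empty loop at a sink acts as the
identity. -/
theorem exists_hom_of_cornerMap [Module.Finite F M] [Module.Finite F N] (hΓ : Γ.RowFinite)
    (g : ∀ b : Γ.Index, corner M b →ₗ[F] corner N b)
    (hg : ∀ b m, loop b ≠ [] → g b ((loopUnit M b).1 m) = (loopUnit N b).1 (g b m)) :
    ∃ f : RightModCat.Hom M N, ∀ b, cornerMap f b = g b := by
  have hM := isRightLeavitt_genAct M
  have hN := isRightLeavitt_genAct N
  obtain ⟨f, hf, hfg⟩ := hM.exists_extension hN hΓ (eq_zero_of_vertex N)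
    (fun b => (corner N b).subtype ∘ₗ g b ∘ₗ toCorner M b)
    (fun b m => genAct_of_mem_corner N (g b _).2)
    (fun b m => congrArg (fun x => (g b x : N)) (toCorner_genAct M b m))
    (fun b m => by
      by_cases hb : loop b = []
      · simp [hb]
      · have := congrArg Subtype.val (hg b (toCorner M b m) hb)
        rw [loopUnit_toCorner, coe_loopUnit] at this
        exact this)
  refine ⟨⟨f, map_act_of_genAct f hf⟩, fun b => LinearMap.ext fun m => Subtype.ext ?_⟩
  have h := hfg b m
  rw [← hf, genAct_of_mem_corner M m.2] at h
  exact h.trans (congrArg (fun x => (g b x : N)) (toCorner_coe M b m))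

theorem finite_corner_ne_bot [Module.Finite F M] : {b : Γ.Index | corner M b ≠ ⊥}.Finite := by
  refine ((isRightLeavitt_genAct M).finite_support.preimage anchor_injective.injOn).subset
    fun b hb => ?_
  obtain ⟨m, hm, hm0⟩ := Submodule.exists_mem_ne_zero_of_ne_bot hb
  exact ⟨m, by rwa [genAct_of_mem_corner M hm]⟩

end Modules

end DiGraph

/-! ### The functor to families, its faithfulness and fullness -/

namespace DiGraph

open RightModCat LaurentPolynomial

section Functors

variable {V : Type u} {E : Type v} (F : Type k) [Field F] (Γ : DiGraph V E)

/-- The finite dimensional right modules over the Leavitt path algebra. -/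
abbrev FDMod := FDRightModCat.{max u v k, k, w} F (LeavittPathAlgebra F Γ)

instance (M : FDMod.{u, v, k, w} F Γ) : Module.Finite F M.obj := M.property

variable {F Γ}

variable (F) in
/-- The part of a module at a sink. -/
noncomputable def sinkFunctor (x : Γ.finMaximalSinks) :
    FDMod.{u, v, k, w} F Γ ⥤ FGModuleCat.{w} F where
  obj M := FGModuleCat.of F (corner M.obj (.inl x))
  map f := ObjectProperty.homMk (ModuleCat.ofHom (cornerMap f.hom (.inl x)))

/-- A linear map which commutes with the automorphisms is linear over the Laurent polynomials. -/
noncomputable def laurentMap {X Y : Type w} [AddCommGroup X] [AddCommGroup Y] [Module F X]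
    [Module F Y] (σ : (Module.End F X)ˣ) (τ : (Module.End F Y)ˣ) (f : X →ₗ[F] Y)
    (hf : ∀ x, f (σ.1 x) = τ.1 (f x)) : LaurentOn σ →ₗ[F[T;T⁻¹]] LaurentOn τ where
  toFun x := LaurentOn.of τ (f ((LaurentOn.of σ).symm x))
  map_add' x y := by simp
  map_smul' p x := by
    refine LaurentPolynomial.map_smul_of_T (A := LaurentOn σ) (B := LaurentOn τ)
      ((LaurentOn.of τ).toAddMonoidHom.comp
        (f.toAddMonoidHom.comp (LaurentOn.of σ).symm.toAddMonoidHom)) (fun a x => ?_)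
      (fun x => ?_) p x
    · obtain ⟨x, rfl⟩ := (LaurentOn.of σ).surjective x
      simp [LaurentOn.C_smul_of]
    · obtain ⟨x, rfl⟩ := (LaurentOn.of σ).surjective x
      simp [LaurentOn.T_smul_of, hf]

/-- The linear map which underlies a map of modules over the Laurent polynomials. -/
noncomputable def laurentMapInv {X Y : Type w} [AddCommGroup X] [AddCommGroup Y] [Module F X]
    [Module F Y] {σ : (Module.End F X)ˣ} {τ : (Module.End F Y)ˣ}
    (f : LaurentOn σ →ₗ[F[T;T⁻¹]] LaurentOn τ) : X →ₗ[F] Y where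
  toFun x := (LaurentOn.of τ).symm (f (LaurentOn.of σ x))
  map_add' x y := by simp
  map_smul' a x := by
    rw [← LaurentOn.C_smul_of, map_smul]
    obtain ⟨y, hy⟩ := (LaurentOn.of τ).surjective (f (LaurentOn.of σ x))
    rw [← hy, LaurentOn.C_smul_of]
    simp

theorem laurentMapInv_apply {X Y : Type w} [AddCommGroup X] [AddCommGroup Y] [Module F X]
    [Module F Y] {σ : (Module.End F X)ˣ} {τ : (Module.End F Y)ˣ}
    (f : LaurentOn σ →ₗ[F[T;T⁻¹]] LaurentOn τ) (x : X) :
    laurentMapInv f (σ.1 x) = τ.1 (laurentMapInv f x) := by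
  change (LaurentOn.of τ).symm (f (LaurentOn.of σ _)) =
    τ.1 ((LaurentOn.of τ).symm (f (LaurentOn.of σ x)))
  rw [← LaurentOn.T_smul_of, map_smul]
  obtain ⟨y, hy⟩ := (LaurentOn.of τ).surjective (f (LaurentOn.of σ x))
  rw [← hy, LaurentOn.T_smul_of]
  simp

variable (F) in
/-- The part of a module at a vertex of a cycle, on which the cycle acts as the variable. -/
noncomputable def cycleFunctor (C : Γ.finMaximalCycles) :
    FDMod.{u, v, k, w} F Γ ⥤ FDLaurentModCat.{k, w} F where
  obj M := ⟨ModuleCat.of F[T;T⁻¹] (LaurentOn (loopUnit M.obj (.inr C))),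
    LaurentOn.finite (loopUnit M.obj (.inr C))⟩
  map f := ObjectProperty.homMk (ModuleCat.ofHom
    (laurentMap _ _ (cornerMap f.hom (.inr C)) (cornerMap_loopUnit f.hom (.inr C))))

theorem isFinitelySupported_sinkFunctor (M : FDMod.{u, v, k, w} F Γ) :
    isFinitelySupported (fun _ : Γ.finMaximalSinks => FGModuleCat.{w} F)
      ((Functor.pi' (sinkFunctor F)).obj M) := by
  refine ((finite_corner_ne_bot (M := M.obj)).preimage Sum.inl_injective.injOn).subset
    fun x hx h => hx (ObjectProperty.isZero_of_isZero_obj ?_)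
  have : Subsingleton (corner M.obj (.inl x)) := Submodule.subsingleton_iff_eq_bot.2 h
  exact @ModuleCat.isZero_of_subsingleton _ _ _ this

theorem isFinitelySupported_cycleFunctor (M : FDMod.{u, v, k, w} F Γ) :
    isFinitelySupported (fun _ : Γ.finMaximalCycles => FDLaurentModCat.{k, w} F)
      ((Functor.pi' (cycleFunctor F)).obj M) := by
  refine ((finite_corner_ne_bot (M := M.obj)).preimage Sum.inr_injective.injOn).subset
    fun C hC h => hC (ObjectProperty.isZero_of_isZero_obj ?_)
  have : Subsingleton (corner M.obj (.inr C)) := Submodule.subsingleton_iff_eq_bot.2 h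
  exact @ModuleCat.isZero_of_subsingleton _ _ _ this

variable (F Γ) in
/-- The functor which sends a module to the family of its parts at the anchors. -/
noncomputable def cornerFunctor : FDMod.{u, v, k, w} F Γ ⥤
    DirectSumCat (fun _ : Γ.finMaximalSinks => FGModuleCat.{w} F) ×
      DirectSumCat (fun _ : Γ.finMaximalCycles => FDLaurentModCat.{k, w} F) :=
  (ObjectProperty.lift _ (Functor.pi' (sinkFunctor F)) isFinitelySupported_sinkFunctor).prod'
    (ObjectProperty.lift _ (Functor.pi' (cycleFunctor F)) isFinitelySupported_cycleFunctor)

theorem faithful_cornerFunctor (hΓ : Γ.RowFinite) : (cornerFunctor.{u, v, k, w} F Γ).Faithful where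
  map_injective {M N} f g h := by
    refine ObjectProperty.hom_ext _ (hom_ext_of_cornerMap hΓ fun b => ?_)
    cases b with
    | inl x =>
      exact congrArg (fun h => (h.1.hom x).hom.hom) h
    | inr C =>
      have := congrArg (fun h => (h.2.hom C).hom.hom) h
      exact LinearMap.ext fun m => LinearMap.congr_fun this m

theorem full_cornerFunctor (hΓ : Γ.RowFinite) : (cornerFunctor.{u, v, k, w} F Γ).Full where
  map_surjective {M N} h := by
    let φ : ∀ C, (cycleFunctor F C).obj M ⟶ (cycleFunctor F C).obj N := fun C => h.2.hom C
    let ψ : ∀ x, (sinkFunctor F x).obj M ⟶ (sinkFunctor F x).obj N := fun x => h.1.hom x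
    let g : ∀ b : Γ.Index, corner M.obj b →ₗ[F] corner N.obj b
      | .inl x => (ψ x).hom.hom
      | .inr C => laurentMapInv (σ := loopUnit M.obj (.inr C)) (τ := loopUnit N.obj (.inr C))
          (φ C).hom.hom
    obtain ⟨f, hf⟩ := exists_hom_of_cornerMap (M := M.obj) (N := N.obj) hΓ g fun b m hb => by
      cases b with
      | inl x => exact absurd rfl hb
      | inr C => exact laurentMapInv_apply _ m
    refine ⟨ObjectProperty.homMk f, Prod.ext ?_ ?_⟩
    · refine ObjectProperty.hom_ext _ (funext fun x => ?_)
      refine ObjectProperty.hom_ext _ (ModuleCat.hom_ext ?_)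
      exact hf (.inl x)
    · refine ObjectProperty.hom_ext _ (funext fun C => ?_)
      refine ObjectProperty.hom_ext _ (ModuleCat.hom_ext ?_)
      exact LinearMap.ext fun m => LinearMap.congr_fun (hf (.inr C)) m

end Functors

/-! ### Essential surjectivity -/

section EssSurj

variable {V : Type u} {E : Type v} {F : Type k} [Field F] {Γ : DiGraph V E}

/-- The vector spaces in a pair of families. -/
def familyCarrier
    (Y₁ : Γ.finMaximalSinks → FGModuleCat.{w} F)
    (Y₂ : Γ.finMaximalCycles → FDLaurentModCat.{k, w} F) : Γ.Index → Type w
  | .inl x => (Y₁ x).obj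
  | .inr C => RestrictScalars F F[T;T⁻¹] (Y₂ C).obj

variable (Y₁ : Γ.finMaximalSinks → FGModuleCat.{w} F)
  (Y₂ : Γ.finMaximalCycles → FDLaurentModCat.{k, w} F)

instance (b : Γ.Index) : AddCommGroup (familyCarrier Y₁ Y₂ b) :=
  match b with
  | .inl x => inferInstanceAs (AddCommGroup (Y₁ x).obj)
  | .inr C => inferInstanceAs (AddCommGroup (RestrictScalars F F[T;T⁻¹] (Y₂ C).obj))

noncomputable instance (b : Γ.Index) : Module F (familyCarrier Y₁ Y₂ b) :=
  match b with
  | .inl x => inferInstanceAs (Module F (Y₁ x).obj)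
  | .inr C => inferInstanceAs (Module F (RestrictScalars F F[T;T⁻¹] (Y₂ C).obj))

instance (b : Γ.Index) : Module.Finite F (familyCarrier Y₁ Y₂ b) :=
  match b with
  | .inl x => (Y₁ x).property
  | .inr C => (Y₂ C).property

/-- The action of the variable as an automorphism. -/
noncomputable def variableEquiv (A : Type w) [AddCommGroup A] [Module F[T;T⁻¹] A] :
    RestrictScalars F F[T;T⁻¹] A ≃ₗ[F] RestrictScalars F F[T;T⁻¹] A :=
  LinearEquiv.ofLinearMap
    ((RestrictScalars.lsmul F F[T;T⁻¹] A) (T 1)) ((RestrictScalars.lsmul F F[T;T⁻¹] A) (T (-1)))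
    (by rw [← Module.End.mul_eq_comp, ← map_mul, ← T_add]; simp [Module.End.one_eq_id])
    (by rw [← Module.End.mul_eq_comp, ← map_mul, ← T_add]; simp [Module.End.one_eq_id])

theorem variableEquiv_apply (A : Type w) [AddCommGroup A] [Module F[T;T⁻¹] A]
    (x : RestrictScalars F F[T;T⁻¹] A) : variableEquiv A x =
      (RestrictScalars.addEquiv F F[T;T⁻¹] A).symm
        ((T 1 : F[T;T⁻¹]) • RestrictScalars.addEquiv F F[T;T⁻¹] A x) := rfl

/-- The automorphisms in a pair of families. -/
noncomputable def familyEquiv (b : Γ.Index) : familyCarrier Y₁ Y₂ b ≃ₗ[F] familyCarrier Y₁ Y₂ b :=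
  match b with
  | .inl _ => LinearEquiv.refl F _
  | .inr C => variableEquiv (Y₂ C).obj

/-- An isomorphism of modules over the Laurent polynomials. -/
noncomputable def laurentIso {X : Type w} [AddCommGroup X] [Module F X] (σ : (Module.End F X)ˣ)
    (A : Type w) [AddCommGroup A] [Module F[T;T⁻¹] A] (f : X ≃ₗ[F] RestrictScalars F F[T;T⁻¹] A)
    (hf : ∀ x, f (σ.1 x) = variableEquiv A (f x)) : LaurentOn σ ≃ₗ[F[T;T⁻¹]] A where
  __ := (LaurentOn.of σ).symm.trans (f.toAddEquiv.trans (RestrictScalars.addEquiv F F[T;T⁻¹] A))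
  map_smul' p x := by
    refine LaurentPolynomial.map_smul_of_T (A := LaurentOn σ) (B := A)
      ((LaurentOn.of σ).symm.trans (f.toAddEquiv.trans
        (RestrictScalars.addEquiv F F[T;T⁻¹] A))).toAddMonoidHom (fun a x => ?_) (fun x => ?_) p x
    · obtain ⟨x, rfl⟩ := (LaurentOn.of σ).surjective x
      simp [LaurentOn.C_smul_of, ← C_eq_algebraMap]
    · obtain ⟨x, rfl⟩ := (LaurentOn.of σ).surjective x
      simp [LaurentOn.T_smul_of, hf, variableEquiv_apply]

theorem exists_module_cornerIso (hΓ : Γ.RowFinite)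
    (h₁ : isFinitelySupported (fun _ : Γ.finMaximalSinks => FGModuleCat.{w} F) Y₁)
    (h₂ : isFinitelySupported (fun _ : Γ.finMaximalCycles => FDLaurentModCat.{k, w} F) Y₂) :
    ∃ M : FDMod.{u, v, k, w} F Γ, (∀ x, Nonempty ((sinkFunctor F x).obj M ≅ Y₁ x)) ∧
      ∀ C, Nonempty ((cycleFunctor F C).obj M ≅ Y₂ C) := by
  have hfin : {b | Nontrivial (familyCarrier Y₁ Y₂ b)}.Finite := by
    refine ((h₁.image Sum.inl).union (h₂.image Sum.inr)).subset fun b hb => ?_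
    cases b with
    | inl x =>
      refine Or.inl ⟨x, fun h => ?_, rfl⟩
      have := ModuleCat.subsingleton_of_isZero_fullSubcategory h
      exact not_nontrivial _ (show Nontrivial (Y₁ x).obj from hb)
    | inr C =>
      refine Or.inr ⟨C, fun h => ?_, rfl⟩
      have := ModuleCat.subsingleton_of_isZero_fullSubcategory h
      exact not_nontrivial _ (show Nontrivial (Y₂ C).obj from hb)
  obtain ⟨M, _, _, R, hMf, hR, ⟨S, hS⟩, p, i, hpi⟩ := exists_module_of_family
    (familyEquiv Y₁ Y₂) hΓ hfin (fun b hb => by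
      cases b with
      | inl x => rfl
      | inr C => exact absurd hb (loop_inr_ne_nil C))
  obtain ⟨act, hact, hspan⟩ := exists_genAct_eq hR hS
  let M' : FDMod.{u, v, k, w} F Γ := ⟨⟨M, act, hspan⟩, hMf⟩
  have hRM : genAct M'.obj = R := funext hact
  -- Since `p b ∘ i b` is the identity and `i b ∘ p b` is the action of the anchor, `p b` restricts
  -- to an isomorphism on the corner.
  let ε : ∀ b, corner M'.obj b ≃ₗ[F] familyCarrier Y₁ Y₂ b := fun b =>
    LinearEquiv.ofLinearMap (p b ∘ₗ (corner M'.obj b).subtype) (toCorner M'.obj b ∘ₗ i b)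
      (LinearMap.ext fun x => by
        change p b (genAct M'.obj (.vertex (anchor b)) (i b x)) = x
        rw [hRM, ← (hpi b).2.1, (hpi b).1, (hpi b).1])
      (LinearMap.ext fun m => by
        change toCorner M'.obj b (i b (p b m.1)) = m
        rw [(hpi b).2.1, ← hRM]
        exact (toCorner_genAct M'.obj b m.1).trans (toCorner_coe M'.obj b m))
  have hε : ∀ b m, ε b ((loopUnit M'.obj b).1 m) = familyEquiv Y₁ Y₂ b (ε b m) := fun b m => by
    change p b (pathAct (genAct M'.obj) (loop b) m.1) = familyEquiv Y₁ Y₂ b (p b m.1)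
    rw [hRM, (hpi b).2.2]
  refine ⟨M', fun x => ⟨ObjectProperty.isoMk _ ?_⟩, fun C => ⟨ObjectProperty.isoMk _ ?_⟩⟩
  · exact (show corner M'.obj (.inl x) ≃ₗ[F] (Y₁ x).obj from ε (.inl x)).toModuleIso
  · have e : LaurentOn (loopUnit M'.obj (.inr C)) ≃ₗ[F[T;T⁻¹]] (Y₂ C).obj :=
      laurentIso (loopUnit M'.obj (.inr C)) (Y₂ C).obj (ε (.inr C)) (hε (.inr C))
    exact e.toModuleIso

theorem essSurj_cornerFunctor (hΓ : Γ.RowFinite) : (cornerFunctor.{u, v, k, w} F Γ).EssSurj where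
  mem_essImage Y := by
    obtain ⟨M, hM₁, hM₂⟩ := exists_module_cornerIso Y.1.obj Y.2.obj hΓ Y.1.property Y.2.property
    exact ⟨M, ⟨Iso.prod
      (ObjectProperty.isoMk _ (Pi.isoMk fun x => (hM₁ x).some))
      (ObjectProperty.isoMk _ (Pi.isoMk fun C => (hM₂ C).some))⟩⟩

end EssSurj

end DiGraph

/-! ### The equivalence of categories -/

theorem mainTheorem3 {V : Type u} {E : Type v} (F : Type k) [Field F] (Γ : DiGraph V E)
    (hΓ : Γ.RowFinite) :
    Nonempty (FDRightModCat.{max u v k, k, w} F (Γ.LeavittPathAlgebra F) ≌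
      DirectSumCat (fun _ : Γ.finMaximalSinks => FGModuleCat.{w} F) ×
        DirectSumCat (fun _ : Γ.finMaximalCycles => FDLaurentModCat.{k, w} F)) := by
  have := DiGraph.faithful_cornerFunctor.{u, v, k, w} (F := F) hΓ
  have := DiGraph.full_cornerFunctor.{u, v, k, w} (F := F) hΓ
  have := DiGraph.essSurj_cornerFunctor.{u, v, k, w} (F := F) hΓ
  have : (DiGraph.cornerFunctor.{u, v, k, w} F Γ).IsEquivalence := {}
  exact ⟨(DiGraph.cornerFunctor.{u, v, k, w} F Γ).asEquivalence⟩
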